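/- Let $d\in\mathbb N$, $T>0$, $p\in[0,1]$, and let $\mathcal P_1(\mathbb R^d)$ be the set of Borel probability measures on $\mathbb R^d$ with finite first moment, with the Wasserstein distance $\mathcal W_1$. Let $H,G^1,\dots,G^d:\mathbb R^d\to\mathbb R^d$ be bounded, locally Lipschitz and of sub-linear growth, $|H(\xi)|\le C_H(1+|\xi|)$, $|G^\ell(\xi)|\le C_G^\ell(1+|\xi|)$. Let $\Theta,\Theta^*$ be independent Bernoulli random variables with $\mathcal P\{\Theta=1\}=\mathcal P\{\Theta^*=1\}=p$, and let $\langle\cdot\rangle$ denote the expectation with respect to $(\Theta,\Theta^*)$. For $\mathbf u,\mathbf u^*\in\mathbb R^d$ put $$K(x,y,\mathbf u,\mathbf u^*)=H(x-y)(1-\Theta)(1-\Theta^*)+\sum_{\ell=1}^d G^\ell(x-y)\,u^*_\ell\,(1-\Theta)\Theta^*+\mathbf u\,\Theta .$$ For every $\alpha>0$ let $\mathbf u_\alpha,\mathbf u_\alpha^*$ be measurable functions of time with values, for $t\in[0,T]$, in a compact set $U\subset\mathbb R^d$ independent of $\alpha$, and suppose that $\lim_{\alpha\to0^+}\mathbf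 u_\alpha(t)=\bar{\mathbf u}(t)$ and $\lim_{\alpha\to0^+}\mathbf u^*_\alpha(t)=\bar{\mathbf u}^*(t)$ for every $t\in[0,T]$. The binary interaction of strength $\alpha$ sends $x$, in an encounter with $y$ at time $t$, to $$\hat x=x+\alpha K(x,y,\mathbf u_\alpha(t),\mathbf u^*_\alpha(t)).$$ Given $\mu_0\in\mathcal P_1(\mathbb R^d)$, a weak solution on $[0,T]$ with initial datum $\mu_0$ of the Boltzmann-type equation $\partial_t\mu=\mathbb Q_\alpha(\mu,\mu)$ with interaction strength $\alpha$ and frequency $\eta$ is a curve $\mu\in L^2([0,T],\mathcal P_1(\mathbb R^d))$, defined at every $t\in[0,T]$, with $\mu(0)=\mu_0$ and, for every $\varphi\in C_c^\infty(\mathbb R^d,\mathbb R)$, $$\frac{d}{dt}\int\varphi\,d\mu(t)=\eta\,\Big\langle\int\!\!\int\big(\varphi(\hat x)-\varphi(x)\big)\,d\mu(t)(x)\,d\mu(t)(y)\Big\rangle .$$ Here and below the identity is understood in the Carathéodory sense: the right-hand side is integrable on $[0,T]$ and $\int\varphi\,d\mu(t)-\int\varphi\,d\mu(0)$ is its integral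 over $[0,t]$ for every $t\in[0,T]$. Introduce the scaling $\alpha=\varepsilon$, $\eta=1/\varepsilon$, and for every $\varepsilon>0$ let $\mu^\varepsilon$ be a weak solution of the scaled equation with initial datum $\mu_0$. Then $$\langle K(x,y,\mathbf u,\mathbf u^*)\rangle=(1-p)^2H(x-y)+p(1-p)\sum_{\ell=1}^dG^\ell(x-y)\,u^*_\ell+p\,\mathbf u$$ for all $x,y,\mathbf u,\mathbf u^*\in\mathbb R^d$, and every sequence $\varepsilon_n\to0^+$ has a subsequence $(\varepsilon_{n_k})$ for which there is a curve $\mu$ in $\mathcal P_1(\mathbb R^d)$ such that $\mathcal W_1(\mu^{\varepsilon_{n_k}}(t),\mu(t))\to0$ for every $t\in[0,T]$ and $\mu$ is a weak solution, with initial datum $\mu_0$, of $$\partial_t\mu+\operatorname{div}\Big[\Big(\int_{\mathbb R^d}\langle K(x,y,\bar{\mathbf u}(t),\bar{\mathbf u}^*(t))\rangle\,d\mu(t)(y)\Big)\mu\Big]=0,$$ that is, $\mu\in L^2([0,T],\mathcal P_1(\mathbb R^d))$, $\mu(0)=\mu_0$, and for every $\varphi\in C_c^\infty(\mathbb R^d,\mathbb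 R)$ $$\frac{d}{dt}\int\varphi\,d\mu(t)=\int\nabla\varphi(x)\cdot\Big(\int\langle K(x,y,\bar{\mathbf u}(t),\bar{\mathbf u}^*(t))\rangle\,d\mu(t)(y)\Big)d\mu(t)(x)$$ in the Carathéodory sense. -/

import Mathlib

open MeasureTheory ProbabilityTheory Filter Topology Set
open scoped ContDiff Gradient ENNReal

noncomputable section

namespace KineticLimit

/-- The state space `ℝ^d` with the Euclidean norm. -/
abbrev E (d : ℕ) : Type := EuclideanSpace ℝ (Fin d)

/-- `P₁(ℝ^d)`: the probability measures on `ℝ^d` with finite first moment. -/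
def P1 (d : ℕ) : Type := {μ : Measure (E d) // IsProbabilityMeasure μ ∧ Integrable (fun x => ‖x‖) μ}

/-- The measure underlying an element of `P₁(ℝ^d)`. -/
def P1.toMeasure {d : ℕ} (μ : P1 d) : Measure (E d) := μ.1

/-- The Wasserstein distance `W₁`: the infimum of the transport costs `∫ |x - y| dπ(x, y)` over all
couplings `π` of `μ` and `ν`. -/
def W1 {d : ℕ} (μ ν : P1 d) : ℝ≥0∞ :=
  ⨅ (π : Measure (E d × E d)) (_ : π.map Prod.fst = μ.toMeasure ∧ π.map Prod.snd = ν.toMeasure),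
    ∫⁻ z, ‖z.1 - z.2‖ₑ ∂π

/-- The hypothesis on the interaction kernels: bounded, locally Lipschitz, sub-linear growth. -/
structure IsInteractionKernel {d : ℕ} (F : E d → E d) : Prop where
  bounded : ∃ M : ℝ, ∀ ξ, ‖F ξ‖ ≤ M
  locallyLipschitz : LocallyLipschitz F
  growth : ∃ C : ℝ, ∀ ξ, ‖F ξ‖ ≤ C * (1 + ‖ξ‖)

/-- The binary interaction field, affine in the controls `u` (of the agent at `x`) and `us` (of the
agent at `y`); `θ` and `θs` indicate whether the agent at `x`, resp. at `y`, is controlled: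
`K = H(x-y) (1-θ)(1-θs) + ∑_ℓ G^ℓ(x-y) us_ℓ (1-θ) θs + u θ`. -/
def field {d : ℕ} (H : E d → E d) (G : Fin d → E d → E d) (θ θs : ℝ) (u us x y : E d) : E d :=
  ((1 - θ) * (1 - θs)) • H (x - y) + ∑ ℓ, (us ℓ * ((1 - θ) * θs)) • G ℓ (x - y) + θ • u

/-- The post-interaction state `x̂ = x + α K`. -/
def postState {d : ℕ} (H : E d → E d) (G : Fin d → E d → E d) (α θ θs : ℝ) (u us x y : E d) :
    E d :=
  x + α • field H G θ θs u us x y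

/-- The explicit averaged kernel `(1-p)² H(x-y) + p(1-p) ∑_ℓ G^ℓ(x-y) us_ℓ + p u`. -/
def avgKernel {d : ℕ} (H : E d → E d) (G : Fin d → E d → E d) (p : ℝ) (u us x y : E d) : E d :=
  (1 - p) ^ 2 • H (x - y) + (p * (1 - p)) • ∑ ℓ, us ℓ • G ℓ (x - y) + p • u

/-- `φ ∈ C_c^∞(ℝ^d, ℝ)`. -/
def IsTestFunction {d : ℕ} (φ : E d → ℝ) : Prop := ContDiff ℝ ∞ φ ∧ HasCompactSupport φ

/-- `d/dt f = g` on `[0, T]` in the Carathéodory sense: `g` is integrable and `f` is its primitive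
(so `f` is absolutely continuous and `f' = g` almost everywhere). -/
def IsCaratheodoryDerivative (T : ℝ) (f g : ℝ → ℝ) : Prop :=
  IntervalIntegrable g volume 0 T ∧ ∀ t ∈ Icc 0 T, f t = f 0 + ∫ s in (0 : ℝ)..t, g s

/-- `μ ∈ L²([0, T], P₁(ℝ^d))`: `μ` is measurable in time and its first moment
`t ↦ ∫ |x| dμ_t(x) = W₁(μ_t, δ₀)` is square integrable. -/
structure IsL2Curve {d : ℕ} (T : ℝ) (μ : ℝ → P1 d) : Prop where
  measurable : AEMeasurable (fun t => (μ t).toMeasure) (volume.restrict (Icc 0 T))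
  moment : MemLp (fun t => ∫ x, ‖x‖ ∂(μ t).toMeasure) 2 (volume.restrict (Icc 0 T))

/-- The weak form of the interaction operator,
`η ⟨∫∫ (φ(x̂) - φ(x)) dν(x) dν(y)⟩`, where `⟨·⟩` is the expectation over the random control
indicators `Θ, Θs`. -/
def collision {d : ℕ} {Ω : Type*} [MeasurableSpace Ω] (P : Measure Ω) (Θ Θs : Ω → ℝ)
    (H : E d → E d) (G : Fin d → E d → E d) (α η : ℝ) (u us : E d) (ν : P1 d) (φ : E d → ℝ) : ℝ :=
  η * ∫ w, (∫ y, (∫ x, (φ (postState H G α (Θ w) (Θs w) u us x y) - φ x) ∂ν.toMeasure)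
    ∂ν.toMeasure) ∂P

/-- `μ` is a weak solution on `[0, T]`, with initial datum `μ₀`, of the Boltzmann-type equation
`∂_t μ = Q_α(μ, μ)` with interaction strength `α`, interaction frequency `η` and controls
`u, us`. -/
structure IsBoltzmannWeakSolution {d : ℕ} {Ω : Type*} [MeasurableSpace Ω] (P : Measure Ω)
    (Θ Θs : Ω → ℝ) (H : E d → E d) (G : Fin d → E d → E d) (T α η : ℝ) (u us : ℝ → E d)
    (μ₀ : P1 d) (μ : ℝ → P1 d) : Prop where
  isL2Curve : IsL2Curve T μ
  initial : μ 0 = μ₀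
  weak_form : ∀ φ : E d → ℝ, IsTestFunction φ →
    IsCaratheodoryDerivative T (fun t => ∫ x, φ x ∂(μ t).toMeasure)
      (fun t => collision P Θ Θs H G α η (u t) (us t) (μ t) φ)

/-- `μ` is a weak solution on `[0, T]`, with initial datum `μ₀`, of the nonlocal continuity equation
`∂_t μ + div ((∫ K_t(x, y) dμ_t(y)) μ) = 0`. -/
structure IsContinuityWeakSolution {d : ℕ} (T : ℝ) (K : ℝ → E d → E d → E d)
    (μ₀ : P1 d) (μ : ℝ → P1 d) : Prop where
  isL2Curve : IsL2Curve T μ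
  initial : μ 0 = μ₀
  weak_form : ∀ φ : E d → ℝ, IsTestFunction φ →
    IsCaratheodoryDerivative T (fun t => ∫ x, φ x ∂(μ t).toMeasure)
      (fun t => ∫ x, inner ℝ (∇ φ x) (∫ y, K t x y ∂(μ t).toMeasure) ∂(μ t).toMeasure)

end KineticLimit

end

open KineticLimit

namespace KineticLimit

/-! The kernels are bounded and the controls stay in a compact set, so `field` is bounded by one
constant `M`, uniformly in the scaling. An interaction of strength `ε` therefore moves a state by at
most `ε M`, and interactions occur at rate `1 / ε`: whatever `ε`, mass travels with speed at most
`M` (`exists_field_bound`, `abs_collision_le`). Three uniform estimates follow: integrals of test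
functions are Lipschitz in time, first moments stay bounded, and tails of the first moment are small
uniformly in `ε` and `t`. For the last two, radial weights are reached from compactly supported test
functions by truncating, mollifying and subtracting from a constant (`integral_norm_sub_pos_le`).

Bounded moments give tightness, so Prokhorov's theorem, a diagonal argument over rational times and
equicontinuity yield a subsequence converging weakly at every time (`exists_subseq_tendsto_curve`).
With uniform tails this improves to convergence in `W1`: a fine partition of unity provides an
explicit transport plan, so no duality is involved (`W1_le_of_partition`,
`tendsto_W1_of_tendsto_of_tail`).

To identify the limit equation, Taylor's formula turns `(φ (x + ε K) - φ x) / ε` into the derivative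
of `φ` along `K` up to an error `O(ε)` uniform in the states. At fixed time the controls converge
and the product measures converge weakly, hence so does the collision term
(`tendsto_scaled_collision`); averaging over the four values of the two indicators produces
`avgKernel`. Dominated convergence in time then passes to the limit in the integrated equation. -/

/-! ### Weak convergence through test functions -/

theorem exists_isTestFunction_one_on {d : ℕ} {K V : Set (E d)} (hK : IsCompact K) (hV : IsOpen V)
    (hKV : K ⊆ V) : ∃ φ : E d → ℝ, IsTestFunction φ ∧ (∀ x, φ x ∈ Icc (0 : ℝ) 1) ∧
      (∀ x ∈ K, φ x = 1) ∧ ∀ x, x ∉ V → φ x = 0 := by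
  obtain ⟨L, hL, hKL, hLV⟩ := exists_compact_between hK hV hKV
  obtain ⟨f, hf, hr, h0, h1⟩ := exists_contMDiff_zero_iff_one_iff_of_isClosed
    (n := (⊤ : ℕ∞)) (modelWithCornersSelf ℝ (E d))
    (s := (interior L)ᶜ) (t := K) isOpen_interior.isClosed_compl hK.isClosed
    (disjoint_left.2 fun x hx hx' => hx (hKL hx'))
  refine ⟨f, ⟨hf.contDiff, HasCompactSupport.intro hL fun x hx => (h0 x).1
    fun h => hx (interior_subset h)⟩, fun x => hr ⟨x, rfl⟩, fun x hx => (h1 x).1 hx,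
    fun x hx => (h0 x).1 fun h => hx (hLV (interior_subset h))⟩

theorem IsTestFunction.integrable {d : ℕ} {φ : E d → ℝ} (hφ : IsTestFunction φ)
    (μ : Measure (E d)) [IsFiniteMeasure μ] : Integrable φ μ :=
  hφ.1.continuous.integrable_of_hasCompactSupport hφ.2

/-- Convergence against test functions to a probability measure is weak convergence. -/
theorem tendsto_probabilityMeasure_of_forall_isTestFunction {d : ℕ} {ι : Type*} {F : Filter ι}
    [F.IsCountablyGenerated] {ν : ι → ProbabilityMeasure (E d)} {ν₀ : ProbabilityMeasure (E d)}
    (h : ∀ φ : E d → ℝ, IsTestFunction φ →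
      Tendsto (fun i => ∫ x, φ x ∂(ν i : Measure (E d))) F (𝓝 (∫ x, φ x ∂(ν₀ : Measure (E d))))) :
    Tendsto ν F (𝓝 ν₀) := by
  rcases F.eq_or_neBot with rfl | hF
  · exact tendsto_bot
  -- Portmanteau criterion on open sets. By inner regularity it suffices to bound the mass of a
  -- compact `K ⊆ V`, and a test function between the indicators of `K` and `V` compares the two.
  refine tendsto_of_forall_isOpen_le_liminf' fun V hV => ?_
  rw [hV.measure_eq_iSup_isCompact]
  refine iSup₂_le fun K hKV => iSup_le fun hK => ?_
  obtain ⟨φ, hφ, h01, h1, h0⟩ := exists_isTestFunction_one_on hK hV hKV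
  have key : ∀ μ : ProbabilityMeasure (E d),
      ENNReal.ofReal (∫ x, φ x ∂(μ : Measure (E d))) = ∫⁻ x, ENNReal.ofReal (φ x) ∂μ := fun μ =>
    ofReal_integral_eq_lintegral_ofReal (hφ.integrable _) (Eventually.of_forall fun x => (h01 x).1)
  have h1' : (ν₀ : Measure (E d)) K ≤ ENNReal.ofReal (∫ x, φ x ∂(ν₀ : Measure (E d))) := by
    rw [key, ← lintegral_indicator_one hK.measurableSet]
    refine lintegral_mono fun x => ?_
    by_cases hx : x ∈ K
    · simp [hx, h1 x hx]
    · simp [hx]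
  refine h1'.trans ?_
  rw [← (ENNReal.tendsto_ofReal (h φ hφ)).liminf_eq]
  refine liminf_le_liminf (Eventually.of_forall fun i => ?_)
  simp only [key]
  rw [← lintegral_indicator_one hV.measurableSet]
  refine lintegral_mono fun x => ?_
  by_cases hx : x ∈ V
  · simpa [hx] using (h01 x).2
  · simp [hx, h0 x hx]

/-- By the portmanteau theorem the mass of an open set is lower semicontinuous along a weakly
continuous curve, hence measurable, and open sets form a generating π-system. -/
theorem measurable_toMeasure_of_continuous {X T : Type*} [TopologicalSpace X] [MeasurableSpace X]
    [BorelSpace X] [HasOuterApproxClosed X] [TopologicalSpace T] [FirstCountableTopology T]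
    [MeasurableSpace T] [OpensMeasurableSpace T]
    {ν : T → ProbabilityMeasure X} (hν : Continuous ν) :
    Measurable fun t => (ν t : Measure X) := by
  refine Measurable.measure_of_isPiSystem_of_isProbabilityMeasure
    (BorelSpace.measurable_eq (α := X)) isPiSystem_isOpen fun V hV => ?_
  refine LowerSemicontinuous.measurable (lowerSemicontinuous_iff_le_liminf.2 fun t => ?_)
  exact ProbabilityMeasure.le_liminf_measure_open_of_tendsto (hν.tendsto t) hV

/-! ### Transport plans built piece by piece -/

instance {d : ℕ} (μ : P1 d) : IsProbabilityMeasure μ.toMeasure := μ.2.1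

/-- The normalized product of two finite measures of the same mass, a coupling of the two. -/
noncomputable def productCoupling {X Y : Type*} [MeasurableSpace X] [MeasurableSpace Y]
    (α : Measure X) (β : Measure Y) : Measure (X × Y) := (α univ)⁻¹ • α.prod β

section productCoupling

variable {X Y : Type*} [MeasurableSpace X] [MeasurableSpace Y] {α : Measure X} {β : Measure Y}

theorem map_fst_productCoupling [IsFiniteMeasure α] [IsFiniteMeasure β] (h : α univ = β univ) :
    (productCoupling α β).map Prod.fst = α := by
  rw [productCoupling, Measure.map_smul, Measure.map_fst_prod, smul_smul, ← h]
  rcases eq_or_ne (α univ) 0 with h0 | h0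
  · rw [Measure.measure_univ_eq_zero.1 h0, smul_zero]
  · rw [ENNReal.inv_mul_cancel h0 (measure_ne_top _ _), one_smul]

theorem map_snd_productCoupling [IsFiniteMeasure α] [IsFiniteMeasure β] (h : α univ = β univ) :
    (productCoupling α β).map Prod.snd = β := by
  rw [productCoupling, Measure.map_smul, Measure.map_snd_prod, smul_smul, h]
  rcases eq_or_ne (β univ) 0 with h0 | h0
  · rw [Measure.measure_univ_eq_zero.1 h0, smul_zero]
  · rw [ENNReal.inv_mul_cancel h0 (measure_ne_top _ _), one_smul]

theorem lintegral_fst_productCoupling [IsFiniteMeasure α] [IsFiniteMeasure β]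
    (h : α univ = β univ) {f : X → ℝ≥0∞} (hf : Measurable f) :
    ∫⁻ z, f z.1 ∂productCoupling α β = ∫⁻ x, f x ∂α := by
  conv_rhs => rw [← map_fst_productCoupling h]
  rw [lintegral_map hf measurable_fst]

theorem lintegral_snd_productCoupling [IsFiniteMeasure α] [IsFiniteMeasure β]
    (h : α univ = β univ) {f : Y → ℝ≥0∞} (hf : Measurable f) :
    ∫⁻ z, f z.2 ∂productCoupling α β = ∫⁻ x, f x ∂β := by
  conv_rhs => rw [← map_snd_productCoupling h]
  rw [lintegral_map hf measurable_snd]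

end productCoupling

/-- If `μ` and `ν` are decomposed into pieces of equal mass, transporting piece by piece bounds
the Wasserstein distance. -/
theorem W1_le_sum_productCoupling {d : ℕ} {ι : Type*} (s : Finset ι) (μ ν : P1 d)
    (α β : ι → Measure (E d)) [∀ i, IsFiniteMeasure (α i)] [∀ i, IsFiniteMeasure (β i)]
    (hμ : ∑ i ∈ s, α i = μ.toMeasure) (hν : ∑ i ∈ s, β i = ν.toMeasure)
    (hαβ : ∀ i, α i univ = β i univ) :
    W1 μ ν ≤ ∑ i ∈ s, ∫⁻ z, ‖z.1 - z.2‖ₑ ∂productCoupling (α i) (β i) := by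
  refine (iInf₂_le (∑ i ∈ s, productCoupling (α i) (β i)) ⟨?_, ?_⟩).trans_eq
    (lintegral_finsetSum_measure _ _ _)
  · rw [← hμ, Measure.map_finset_sum measurable_fst.aemeasurable]
    exact Finset.sum_congr rfl fun i _ => map_fst_productCoupling (hαβ i)
  · rw [← hν, Measure.map_finset_sum measurable_snd.aemeasurable]
    exact Finset.sum_congr rfl fun i _ => map_snd_productCoupling (hαβ i)

theorem lintegral_productCoupling_le_moments {d : ℕ} (α β : Measure (E d)) [IsFiniteMeasure α]
    [IsFiniteMeasure β] (h : α univ = β univ) :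
    ∫⁻ z, ‖z.1 - z.2‖ₑ ∂productCoupling α β ≤ ∫⁻ x, ‖x‖ₑ ∂α + ∫⁻ x, ‖x‖ₑ ∂β := by
  rw [← lintegral_fst_productCoupling h measurable_enorm,
    ← lintegral_snd_productCoupling h measurable_enorm,
    ← lintegral_add_left (by fun_prop)]
  exact lintegral_mono fun z => enorm_sub_le

/-- Both marginals of the coupling live on the set where `χ` is nonzero, whose diameter is at most
`δ`, so no mass travels further than `δ`. -/
theorem lintegral_productCoupling_le_diam {d : ℕ} {μ ν : Measure (E d)} [IsFiniteMeasure μ]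
    [IsFiniteMeasure ν] {χ : E d → ℝ≥0∞} (hχ : Measurable χ) {δ : ℝ≥0∞}
    (hδ : ∀ x y, χ x ≠ 0 → χ y ≠ 0 → ‖x - y‖ₑ ≤ δ) (a b : ℝ≥0∞)
    [IsFiniteMeasure (a • μ.withDensity χ)] [IsFiniteMeasure (b • ν.withDensity χ)]
    (h : (a • μ.withDensity χ) univ = (b • ν.withDensity χ) univ) :
    ∫⁻ z, ‖z.1 - z.2‖ₑ ∂productCoupling (a • μ.withDensity χ) (b • ν.withDensity χ)
      ≤ δ * (a • μ.withDensity χ) univ := by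
  have key : ∀ (ρ : Measure (E d)) (c : ℝ≥0∞), ∀ᵐ x ∂(c • ρ.withDensity χ), χ x ≠ 0 := by
    intro ρ c
    refine Measure.ae_smul_measure ?_ c
    rw [ae_withDensity_iff hχ]
    exact Eventually.of_forall fun x hx => hx
  have h1 : ∀ᵐ z ∂productCoupling (a • μ.withDensity χ) (b • ν.withDensity χ), χ z.1 ≠ 0 := by
    refine ae_of_ae_map (p := fun x => χ x ≠ 0) measurable_fst.aemeasurable ?_
    rw [map_fst_productCoupling h]; exact key _ _
  have h2 : ∀ᵐ z ∂productCoupling (a • μ.withDensity χ) (b • ν.withDensity χ), χ z.2 ≠ 0 := by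
    refine ae_of_ae_map (p := fun x => χ x ≠ 0) measurable_snd.aemeasurable ?_
    rw [map_snd_productCoupling h]; exact key _ _
  calc _ ≤ ∫⁻ _, δ ∂productCoupling (a • μ.withDensity χ) (b • ν.withDensity χ) :=
        lintegral_mono_ae (by filter_upwards [h1, h2] with z hz1 hz2 using hδ _ _ hz1 hz2)
    _ = δ * (a • μ.withDensity χ) univ := by
        exact (lintegral_fst_productCoupling h (f := fun _ => δ) measurable_const).trans
          (lintegral_const δ)

section residual

variable {d : ℕ} {ι : Type*} [Fintype ι] {χ : ι → E d → ℝ≥0∞} {c : ι → ℝ≥0∞}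

theorem sum_weight_mul_le_one (hsum : ∀ x, ∑ i, χ i x ≤ 1) (hc : ∀ i, c i ≤ 1) (x : E d) :
    ∑ i, c i * χ i x ≤ 1 :=
  (Finset.sum_le_sum fun i _ => mul_le_of_le_one_left' (hc i)).trans (hsum x)

theorem sum_withDensity_add_residual (μ : Measure (E d)) (hχ : ∀ i, Measurable (χ i))
    (hsum : ∀ x, ∑ i, χ i x ≤ 1) (hc : ∀ i, c i ≤ 1) :
    ∑ i, c i • μ.withDensity (χ i) + μ.withDensity (fun x => 1 - ∑ i, c i * χ i x) = μ := by
  have h1 : ∑ i, c i • μ.withDensity (χ i) = μ.withDensity (fun x => ∑ i, c i * χ i x) := by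
    ext s hs
    rw [withDensity_apply _ hs, lintegral_finsetSum _ fun i _ => (hχ i).const_mul _,
      Measure.finsetSum_apply]
    refine Finset.sum_congr rfl fun i _ => ?_
    rw [Measure.smul_apply, withDensity_apply _ hs, lintegral_const_mul _ (hχ i), smul_eq_mul]
  rw [h1, ← withDensity_add_left (Finset.measurable_sum _ fun i _ => (hχ i).const_mul _)]
  conv_rhs => rw [← withDensity_one (μ := μ)]
  congr 1
  ext x
  exact add_tsub_cancel_of_le (sum_weight_mul_le_one hsum hc x)

/-- The residual density is at most `(1 - ∑ χ i) + ∑ (1 - c i) χ i`: mass outside the partition,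
plus mass withheld inside the cells, where the norm is at most `R`. -/
theorem lintegral_enorm_residual_le (μ : Measure (E d)) (hχ : ∀ i, Measurable (χ i))
    (hsum : ∀ x, ∑ i, χ i x ≤ 1) (hc : ∀ i, c i ≤ 1) {R : ℝ≥0∞}
    (hR : ∀ i x, χ i x ≠ 0 → ‖x‖ₑ ≤ R) :
    ∫⁻ x, ‖x‖ₑ ∂μ.withDensity (fun x => 1 - ∑ i, c i * χ i x) ≤
      ∫⁻ x, (1 - ∑ i, χ i x) * ‖x‖ₑ ∂μ + ∑ i, R * ((1 - c i) * ∫⁻ x, χ i x ∂μ) := by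
  have hmeas : Measurable fun x => ∑ i, c i * χ i x :=
    Finset.measurable_sum _ fun i _ => (hχ i).const_mul _
  have hmeas' : Measurable fun x => 1 - ∑ i, c i * χ i x := measurable_const.sub hmeas
  rw [lintegral_withDensity_eq_lintegral_mul _ hmeas' measurable_enorm]
  have h1 : ∀ i, R * ((1 - c i) * ∫⁻ x, χ i x ∂μ) = ∫⁻ x, R * ((1 - c i) * χ i x) ∂μ := fun i => by
    rw [lintegral_const_mul _ ((hχ i).const_mul _), lintegral_const_mul _ (hχ i)]
  simp only [h1]
  rw [← lintegral_finsetSum _ fun i _ => ((hχ i).const_mul _).const_mul _,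
    ← lintegral_add_right _ (Finset.measurable_sum _ fun i _ => ((hχ i).const_mul _).const_mul _)]
  refine lintegral_mono fun x => ?_
  have h2 : 1 - ∑ i, c i * χ i x ≤ (1 - ∑ i, χ i x) + ∑ i, (1 - c i) * χ i x := by
    rw [tsub_le_iff_right, add_assoc, ← Finset.sum_add_distrib]
    simp only [← add_mul, tsub_add_cancel_of_le (hc _), one_mul]
    exact (tsub_add_cancel_of_le (hsum x)).ge
  refine (mul_le_mul_left h2 ‖x‖ₑ).trans ?_
  rw [add_mul, Finset.sum_mul]
  refine add_le_add le_rfl (Finset.sum_le_sum fun i _ => ?_)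
  by_cases hx : χ i x = 0
  · simp [hx]
  · rw [mul_comm]
    exact mul_le_mul_left (hR i x hx) _

end residual

/-- In each cell the common mass `min (a i) (b i)` is transported inside the cell, at cost at most
`δ` per unit. What remains of the two measures has equal total mass and is coupled arbitrarily, at a
cost bounded by the sum of the two first moments. -/
theorem W1_le_of_partition {d : ℕ} {ι : Type*} [Fintype ι] (μ ν : P1 d) {χ : ι → E d → ℝ≥0∞}
    (hχ : ∀ i, Measurable (χ i)) (hsum : ∀ x, ∑ i, χ i x ≤ 1) {δ R : ℝ≥0∞}
    (hδ : ∀ i x y, χ i x ≠ 0 → χ i y ≠ 0 → ‖x - y‖ₑ ≤ δ) (hR : ∀ i x, χ i x ≠ 0 → ‖x‖ₑ ≤ R) :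
    W1 μ ν ≤ δ + ((∫⁻ x, (1 - ∑ i, χ i x) * ‖x‖ₑ ∂μ.toMeasure
        + ∑ i, R * (∫⁻ x, χ i x ∂μ.toMeasure - ∫⁻ x, χ i x ∂ν.toMeasure))
      + (∫⁻ x, (1 - ∑ i, χ i x) * ‖x‖ₑ ∂ν.toMeasure
        + ∑ i, R * (∫⁻ x, χ i x ∂ν.toMeasure - ∫⁻ x, χ i x ∂μ.toMeasure))) := by
  set a : ι → ℝ≥0∞ := fun i => ∫⁻ x, χ i x ∂μ.toMeasure
  set b : ι → ℝ≥0∞ := fun i => ∫⁻ x, χ i x ∂ν.toMeasure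
  have hχ1 : ∀ i x, χ i x ≤ 1 := fun i x =>
    (Finset.single_le_sum (f := fun i => χ i x) (fun _ _ => zero_le) (Finset.mem_univ i)).trans
      (hsum x)
  have hle1 : ∀ (ρ : P1 d) i, ∫⁻ x, χ i x ∂ρ.toMeasure ≤ 1 := fun ρ i =>
    (lintegral_mono (hχ1 i)).trans (by simp)
  -- The fraction of a cell of mass `A` that is matched with mass `B`. For an empty cell the
  -- quotient `0 / 0` equals `0`, and the three relations still hold.
  have hweight : ∀ A B : ℝ≥0∞, A ≤ 1 → min A B / A * A = min A B ∧ min A B / A ≤ 1 ∧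
      (1 - min A B / A) * A = A - B := by
    intro A B hA
    have hA' : A ≠ ⊤ := ne_top_of_le_ne_top ENNReal.one_ne_top hA
    have h1 : min A B / A * A = min A B := by
      rcases eq_or_ne A 0 with h0 | h0
      · simp [h0]
      · exact ENNReal.div_mul_cancel h0 hA'
    refine ⟨h1, ENNReal.div_le_of_le_mul (by simp), ?_⟩
    rw [ENNReal.sub_mul fun _ _ => hA', one_mul, h1]
    rcases le_total A B with h | h
    · rw [min_eq_left h, tsub_self, tsub_eq_zero_of_le h]
    · rw [min_eq_right h]
  set m : ι → ℝ≥0∞ := fun i => min (a i) (b i) with hm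
  have hca := fun i => hweight (a i) (b i) (hle1 μ i)
  have hcb : ∀ i, m i / b i * b i = m i ∧ m i / b i ≤ 1 ∧ (1 - m i / b i) * b i = b i - a i :=
    fun i => by simpa only [hm, min_comm (a i)] using hweight (b i) (a i) (hle1 ν i)
  have hdμ := sum_withDensity_add_residual μ.toMeasure hχ hsum fun i => (hca i).2.1
  have hdν := sum_withDensity_add_residual ν.toMeasure hχ hsum fun i => (hcb i).2.1
  have hmass : ∀ (ρ : P1 d) (c : ι → ℝ≥0∞) i, (c i • ρ.toMeasure.withDensity (χ i)) univ =
      c i * ∫⁻ x, χ i x ∂ρ.toMeasure := fun ρ c i => by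
    rw [Measure.smul_apply, withDensity_apply _ MeasurableSet.univ, setLIntegral_univ, smul_eq_mul]
  -- The index `none` carries the residual measure, the indices `some i` the matched parts of the
  -- cells.
  set α : Option ι → Measure (E d) := fun j => j.elim
    (μ.toMeasure.withDensity (fun x => 1 - ∑ i, m i / a i * χ i x))
    (fun i => (m i / a i) • μ.toMeasure.withDensity (χ i))
  set β : Option ι → Measure (E d) := fun j => j.elim
    (ν.toMeasure.withDensity (fun x => 1 - ∑ i, m i / b i * χ i x))
    (fun i => (m i / b i) • ν.toMeasure.withDensity (χ i))
  have hαsum : ∑ j, α j = μ.toMeasure := by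
    rw [Fintype.sum_option, add_comm]; exact hdμ
  have hβsum : ∑ j, β j = ν.toMeasure := by
    rw [Fintype.sum_option, add_comm]; exact hdν
  have : ∀ j, IsFiniteMeasure (α j) := fun j => isFiniteMeasure_of_le μ.toMeasure <| by
    rw [← hαsum]; exact Finset.single_le_sum (fun _ _ => Measure.zero_le _) (Finset.mem_univ j)
  have : ∀ j, IsFiniteMeasure (β j) := fun j => isFiniteMeasure_of_le ν.toMeasure <| by
    rw [← hβsum]; exact Finset.single_le_sum (fun _ _ => Measure.zero_le _) (Finset.mem_univ j)
  have hsome : ∀ i, α (some i) univ = m i ∧ β (some i) univ = m i := fun i =>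
    ⟨(hmass μ (fun i => m i / a i) i).trans (hca i).1,
      (hmass ν (fun i => m i / b i) i).trans (hcb i).1⟩
  have hmα : α none univ + ∑ i, m i = 1 := by
    have := congrArg (fun ρ : Measure (E d) => ρ univ) hαsum
    simpa [Fintype.sum_option, hsome] using this
  have hmβ : β none univ + ∑ i, m i = 1 := by
    have := congrArg (fun ρ : Measure (E d) => ρ univ) hβsum
    simpa [Fintype.sum_option, hsome] using this
  have hmtop : ∑ i, m i ≠ ⊤ :=
    ne_top_of_le_ne_top ENNReal.one_ne_top (hmα ▸ le_add_self)
  -- The residuals have the same mass because both totals are `1` and the matched masses agree and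
  -- are finite.
  have hαβ : ∀ j, α j univ = β j univ := by
    rintro (_ | i)
    · exact (ENNReal.add_left_inj hmtop).1 (hmα.trans hmβ.symm)
    · rw [(hsome i).1, (hsome i).2]
  refine (W1_le_sum_productCoupling Finset.univ μ ν α β hαsum hβsum hαβ).trans ?_
  rw [Fintype.sum_option, add_comm]
  refine add_le_add ?_ ?_
  · calc ∑ i, ∫⁻ z, ‖z.1 - z.2‖ₑ ∂productCoupling (α (some i)) (β (some i))
        ≤ ∑ i, δ * m i := Finset.sum_le_sum fun i _ => by
          have h1 : IsFiniteMeasure ((m i / a i) • μ.toMeasure.withDensity (χ i)) :=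
            inferInstanceAs (IsFiniteMeasure (α (some i)))
          have h2 : IsFiniteMeasure ((m i / b i) • ν.toMeasure.withDensity (χ i)) :=
            inferInstanceAs (IsFiniteMeasure (β (some i)))
          rw [← (hsome i).1]
          exact lintegral_productCoupling_le_diam (hχ i) (hδ i) _ _ (hαβ (some i))
      _ ≤ δ := by
          rw [← Finset.mul_sum]
          exact mul_le_of_le_one_right' (hmα ▸ le_add_self)
  · refine (lintegral_productCoupling_le_moments _ _ (hαβ none)).trans (add_le_add ?_ ?_)
    · refine (lintegral_enorm_residual_le μ.toMeasure hχ hsum (fun i => (hca i).2.1) hR).trans_eq ?_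
      congr 1
      exact Finset.sum_congr rfl fun i _ => by rw [← (hca i).2.2]
    · refine (lintegral_enorm_residual_le ν.toMeasure hχ hsum (fun i => (hcb i).2.1) hR).trans_eq ?_
      congr 1
      exact Finset.sum_congr rfl fun i _ => by rw [← (hcb i).2.2]

/-! ### From weak convergence to Wasserstein convergence -/

open scoped BoundedContinuousFunction NNReal
/-- A partition of unity on a ball subordinate to small balls. -/
theorem exists_boundedContinuous_partition {d : ℕ} (R : ℝ) {δ : ℝ} (hδ : 0 < δ) :
    ∃ (s : Finset (E d)) (χ : s → E d →ᵇ ℝ≥0), (∀ x, ∑ i, χ i x ≤ 1) ∧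
      (∀ x, ‖x‖ ≤ R → ∑ i, χ i x = 1) ∧ (∀ i x y, χ i x ≠ 0 → χ i y ≠ 0 → ‖x - y‖ ≤ 4 * δ) ∧
      ∀ i x, χ i x ≠ 0 → ‖x‖ ≤ R + 2 * δ := by
  obtain ⟨t, htR, htf, hcov⟩ := (isCompact_closedBall (0 : E d) R).finite_cover_balls hδ
  set s := htf.toFinset
  let b : s → E d → ℝ≥0 := fun i x => Real.toNNReal (2 * δ - dist x i.1)
  have hbcont : ∀ i, Continuous (b i) := fun i => by fun_prop
  -- The lower cap `δ` keeps the denominator positive everywhere. It is inactive on the ball: a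
  -- point there is within `δ` of some centre, whose bump is then at least `δ`, so the quotients sum
  -- to exactly `1`.
  let N : E d → ℝ≥0 := fun x => max (∑ i, b i x) (Real.toNNReal δ)
  have hNcont : Continuous N := by fun_prop
  have hN0 : ∀ x, N x ≠ 0 := fun x =>
    ((Real.toNNReal_pos.2 hδ).trans_le (le_max_right _ _)).ne'
  have hle : ∀ i x, b i x / N x ≤ 1 := fun i x => div_le_one_of_le₀
    ((Finset.single_le_sum (f := fun i => b i x) (fun _ _ => zero_le)
      (Finset.mem_univ i)).trans (le_max_left _ _)) zero_le
  let χ : s → E d →ᵇ ℝ≥0 := fun i => BoundedContinuousFunction.mkOfBound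
    ⟨fun x => b i x / N x, (hbcont i).div₀ hNcont hN0⟩ 1 fun x y => by
      rw [NNReal.dist_eq, abs_sub_le_iff]
      have h1 : ((b i x / N x : ℝ≥0) : ℝ) ≤ 1 := by exact_mod_cast hle i x
      have h2 : ((b i y / N y : ℝ≥0) : ℝ) ≤ 1 := by exact_mod_cast hle i y
      have h3 := (b i x / N x).coe_nonneg
      have h4 := (b i y / N y).coe_nonneg
      exact ⟨by simp only [ContinuousMap.coe_mk]; linarith,
        by simp only [ContinuousMap.coe_mk]; linarith⟩
  have hχ : ∀ i x, χ i x = b i x / N x := fun i x => rfl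
  have hsupp : ∀ i x, χ i x ≠ 0 → dist x i.1 ≤ 2 * δ := fun i x hx => by
    by_contra! h
    apply hx
    rw [hχ]
    simp only [b]
    rw [Real.toNNReal_of_nonpos (by linarith), zero_div]
  have hsum : ∀ x, ∑ i, χ i x = (∑ i, b i x) / N x := fun x => by
    simp only [hχ, Finset.sum_div]
  refine ⟨s, χ, fun x => ?_, fun x hx => ?_, fun i x y hx hy => ?_, fun i x hx => ?_⟩
  · rw [hsum]
    exact div_le_one_of_le₀ (le_max_left _ _) zero_le
  · rw [hsum, div_eq_one_iff_eq (hN0 x)]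
    obtain ⟨c, hc, hxc⟩ := mem_iUnion₂.1 (hcov (by simpa using hx))
    have hcs : c ∈ s := htf.mem_toFinset.2 hc
    refine (max_eq_left ?_).symm
    refine le_trans ?_ (Finset.single_le_sum (f := fun i => b i x) (fun _ _ => zero_le)
      (Finset.mem_univ ⟨c, hcs⟩))
    exact Real.toNNReal_le_toNNReal (by have := Metric.mem_ball.1 hxc; simp only; linarith)
  · rw [← dist_eq_norm]
    linarith [dist_triangle_right x y i.1, hsupp i x hx, hsupp i y hy]
  · have h1 := htR (htf.mem_toFinset.1 i.2)
    rw [Metric.mem_closedBall] at h1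
    rw [← dist_zero_right]
    linarith [dist_triangle x i.1 0, hsupp i x hx]

/-- The element of `P₁` as an element of the space of probability measures with the topology of
weak convergence. -/
noncomputable def P1.toProbabilityMeasure {d : ℕ} (μ : P1 d) : ProbabilityMeasure (E d) :=
  ⟨μ.toMeasure, inferInstance⟩

theorem P1.lintegral_enorm_lt_top {d : ℕ} (μ : P1 d) : ∫⁻ x, ‖x‖ₑ ∂μ.toMeasure < ⊤ := by
  have h := μ.2.2.2
  simpa [HasFiniteIntegral, P1.toMeasure] using h

theorem P1.exists_lintegral_tail_le {d : ℕ} (μ : P1 d) {δ : ℝ≥0∞} (hδ : 0 < δ) :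
    ∃ R : ℝ, ∫⁻ x in {x | R < ‖x‖}, ‖x‖ₑ ∂μ.toMeasure ≤ δ := by
  have h := tendsto_measure_iInter_atTop (μ := μ.toMeasure) 
    (s := fun n : ℕ => {x : E d | (n : ℝ) < ‖x‖})
    (fun n => (measurableSet_lt measurable_const measurable_norm).nullMeasurableSet)
    (fun m n hmn x (hx : (n : ℝ) < ‖x‖) =>
      show (m : ℝ) < ‖x‖ from (Nat.cast_le.2 hmn).trans_lt hx) ⟨0, measure_ne_top _ _⟩
  have h0 : ⋂ n : ℕ, {x : E d | (n : ℝ) < ‖x‖} = ∅ := by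
    refine eq_empty_of_forall_notMem fun x hx => ?_
    obtain ⟨n, hn⟩ := exists_nat_ge ‖x‖
    exact absurd (mem_iInter.1 hx n) (not_lt.2 hn)
  rw [h0, measure_empty] at h
  obtain ⟨n, hn⟩ := ((tendsto_order.1 (tendsto_setLIntegral_zero
    μ.lintegral_enorm_lt_top.ne h)).2 δ hδ).exists
  exact ⟨n, hn.le⟩

/-- Weak convergence together with uniform integrability of the norm implies convergence in the
Wasserstein distance. -/
theorem tendsto_W1_of_tendsto_of_tail {d : ℕ} {ν : ℕ → P1 d} {ν₀ : P1 d}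
    (h : Tendsto (fun n => (ν n).toProbabilityMeasure) atTop (𝓝 ν₀.toProbabilityMeasure))
    (htail : ∀ δ : ℝ≥0∞, 0 < δ → ∃ R : ℝ, ∀ᶠ n in atTop,
      ∫⁻ x in {x | R < ‖x‖}, ‖x‖ₑ ∂(ν n).toMeasure ≤ δ) :
    Tendsto (fun n => W1 (ν n) ν₀) atTop (𝓝 0) := by
  refine ENNReal.tendsto_nhds_zero.2 fun ε hε => ?_
  -- One quarter each for the cell diameter, the two tails, and the mass differences in the cells.
  have he : 0 < ε / 4 := ENNReal.div_pos hε.ne' (by simp)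
  obtain ⟨r, hr0, hre⟩ := ENNReal.lt_iff_exists_nnreal_btwn.1 he
  obtain ⟨R₀, hR₀⟩ := ν₀.exists_lintegral_tail_le he
  obtain ⟨R₁, hR₁⟩ := htail _ he
  -- Scale `r / 4` gives cells of diameter at most `r`, which is below `ε / 4`; the ball contains
  -- both tail radii.
  obtain ⟨s, χ, hsum, hone, hdiam, hsupp⟩ := exists_boundedContinuous_partition (d := d) (max R₀ R₁)
    (δ := (r : ℝ) / 4) (div_pos (by exact_mod_cast hr0) (by norm_num))
  have hmeas : ∀ i, Measurable fun x => (χ i x : ℝ≥0∞) := fun i =>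
    (χ i).continuous.measurable.coe_nnreal_ennreal
  have hsum' : ∀ x, ∑ i, (χ i x : ℝ≥0∞) ≤ 1 := fun x => by exact_mod_cast hsum x
  have htail' : ∀ (ρ : P1 d) (R : ℝ), R ≤ max R₀ R₁ →
      ∫⁻ x in {x | R < ‖x‖}, ‖x‖ₑ ∂ρ.toMeasure ≤ ε / 4 →
      ∫⁻ x, (1 - ∑ i, (χ i x : ℝ≥0∞)) * ‖x‖ₑ ∂ρ.toMeasure ≤ ε / 4 := by
    intro ρ R hR hle
    refine le_trans ?_ hle
    rw [← lintegral_indicator (measurableSet_lt measurable_const measurable_norm)]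
    refine lintegral_mono fun x => ?_
    by_cases hx : R < ‖x‖
    · rw [indicator_of_mem (by exact hx)]
      exact mul_le_of_le_one_left' tsub_le_self
    · have h1 : ∑ i, (χ i x : ℝ≥0∞) = 1 := by
        exact_mod_cast hone x ((not_lt.1 hx).trans hR)
      rw [h1, tsub_self, zero_mul]
      exact zero_le
  have hconv : ∀ i, Tendsto (fun n => ∫⁻ x, χ i x ∂(ν n).toMeasure) atTop
      (𝓝 (∫⁻ x, χ i x ∂ν₀.toMeasure)) := fun i =>
    ProbabilityMeasure.tendsto_iff_forall_lintegral_tendsto.1 h (χ i)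
  have hfin : ∀ i, ∫⁻ x, χ i x ∂ν₀.toMeasure ≠ ⊤ := fun i => by
    refine ne_top_of_le_ne_top ENNReal.one_ne_top ((lintegral_mono (g := fun _ => 1) fun x => ?_).trans
      (by simp))
    exact (Finset.single_le_sum (f := fun i => (χ i x : ℝ≥0∞)) (fun _ _ => zero_le)
      (Finset.mem_univ i)).trans (hsum' x)
  set ρ : ℝ≥0∞ := ENNReal.ofReal (max R₀ R₁ + 2 * ((r : ℝ) / 4))
  have hlim : Tendsto (fun n =>
      ∑ i, ρ * (∫⁻ x, χ i x ∂(ν n).toMeasure - ∫⁻ x, χ i x ∂ν₀.toMeasure) +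
      ∑ i, ρ * (∫⁻ x, χ i x ∂ν₀.toMeasure - ∫⁻ x, χ i x ∂(ν n).toMeasure)) atTop (𝓝 0) := by
    have hz : (0 : ℝ≥0∞) = ∑ i : s, ρ * (∫⁻ x, χ i x ∂ν₀.toMeasure - ∫⁻ x, χ i x ∂ν₀.toMeasure) +
      ∑ i : s, ρ * (∫⁻ x, χ i x ∂ν₀.toMeasure - ∫⁻ x, χ i x ∂ν₀.toMeasure) := by simp
    rw [hz]
    refine Tendsto.add (tendsto_finsetSum _ fun i _ => ?_) (tendsto_finsetSum _ fun i _ => ?_)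
    · exact ENNReal.Tendsto.const_mul
        (ENNReal.Tendsto.sub (hconv i) tendsto_const_nhds (Or.inr (hfin i)))
        (Or.inr ENNReal.ofReal_ne_top)
    · exact ENNReal.Tendsto.const_mul
        (ENNReal.Tendsto.sub tendsto_const_nhds (hconv i) (Or.inl (hfin i)))
        (Or.inr ENNReal.ofReal_ne_top)
  filter_upwards [hR₁, ENNReal.tendsto_nhds_zero.1 hlim _ he] with n hn hn'
  refine (W1_le_of_partition (ν n) ν₀ hmeas hsum' (δ := ε / 4) (R := ρ) ?_ ?_).trans ?_
  · intro i x y hx hy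
    have h1 := hdiam i x y (by exact_mod_cast hx) (by exact_mod_cast hy)
    refine le_trans ?_ hre.le
    rw [← ofReal_norm, ← ENNReal.ofReal_coe_nnreal]
    exact ENNReal.ofReal_le_ofReal (by linarith)
  · intro i x hx
    rw [← ofReal_norm]
    exact ENNReal.ofReal_le_ofReal (hsupp i x (by exact_mod_cast hx))
  · rw [add_add_add_comm]
    refine (add_le_add le_rfl (add_le_add (add_le_add (htail' _ _ (le_max_right _ _) hn)
      (htail' _ _ (le_max_left _ _) hR₀)) hn')).trans_eq ?_
    calc _ = 4 * (ε / 4) := by ring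
      _ = ε := ENNReal.mul_div_cancel (by simp) (by simp)

/-! ### Mollification of Lipschitz functions -/

open scoped Convolution in
/-- Mollification of a compactly supported `1`-Lipschitz function. -/
theorem exists_isTestFunction_approx {d : ℕ} {f : E d → ℝ} (hf : LipschitzWith 1 f)
    (hc : HasCompactSupport f) {δ : ℝ} (hδ : 0 < δ) :
    ∃ φ : E d → ℝ, IsTestFunction φ ∧ (∀ x y, |φ x - φ y| ≤ ‖x - y‖) ∧
      (∀ x, |φ x - f x| ≤ δ) ∧ ∀ x, (∀ z, ‖z - x‖ < δ → f z = f x) → φ x = f x := by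
  let ρ : ContDiffBump (0 : E d) := ⟨δ / 2, δ, half_pos hδ, half_lt_self hδ⟩
  have hloc : LocallyIntegrable f (volume : Measure (E d)) := hf.continuous.locallyIntegrable
  have hconv : ConvolutionExists (ρ.normed volume) f (ContinuousLinearMap.lsmul ℝ ℝ) volume :=
    hc.convolutionExists_right _ ρ.continuous_normed.locallyIntegrable hf.continuous
  refine ⟨(ρ.normed volume ⋆[ContinuousLinearMap.lsmul ℝ ℝ, volume] f : E d → ℝ), ⟨?_, ?_⟩,
    fun x y => ?_, fun x => ?_, fun x hx => ?_⟩
  · exact ρ.hasCompactSupport_normed.contDiff_convolution_left _ ρ.contDiff_normed hloc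
  · exact ρ.hasCompactSupport_normed.convolution _ hc
  · have hx : Integrable (fun t => ρ.normed volume t • f (x - t)) volume := hconv x
    have hy : Integrable (fun t => ρ.normed volume t • f (y - t)) volume := hconv y
    simp only [MeasureTheory.convolution, ContinuousLinearMap.lsmul_apply]
    rw [← integral_sub hx hy, ← Real.norm_eq_abs]
    calc _ ≤ ∫ t, ρ.normed volume t * ‖x - y‖ := by
          refine norm_integral_le_of_norm_le (ρ.integrable_normed.mul_const _)
            (Eventually.of_forall fun t => ?_)
          rw [← smul_sub, norm_smul, Real.norm_of_nonneg (ρ.nonneg_normed t)]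
          refine mul_le_mul_of_nonneg_left ?_ (ρ.nonneg_normed t)
          have := hf.dist_le_mul (x - t) (y - t)
          rwa [dist_eq_norm, dist_eq_norm, sub_sub_sub_cancel_right, NNReal.coe_one,
            one_mul] at this
      _ = ‖x - y‖ := by rw [integral_mul_const, ρ.integral_normed, one_mul]
  · rw [← Real.dist_eq]
    refine ρ.dist_normed_convolution_le hf.continuous.aestronglyMeasurable fun z hz => ?_
    have := hf.dist_le_mul z x
    rw [NNReal.coe_one, one_mul] at this
    exact this.trans (Metric.mem_ball.1 hz).le
  · exact ρ.normed_convolution_eq_right fun z hz => hx z (by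
      rw [← dist_eq_norm]; exact Metric.mem_ball.1 hz)

/-! ### Expectation over the control indicators -/

section dynamics

variable {Ω : Type*} [MeasurableSpace Ω] {P : Measure Ω} {p : unitInterval} {Θ Θs : Ω → ℝ}

theorem ae_eq_zero_or_one_of_hasLaw_bernoulli
    (hΘ : HasLaw Θ (bernoulliMeasure (1 : ℝ) 0 p) P) : ∀ᵐ w ∂P, Θ w = 0 ∨ Θ w = 1 := by
  have hm : MeasurableSet {x : ℝ | x = 0 ∨ x = 1} :=
    (measurableSet_singleton (0 : ℝ)).union (measurableSet_singleton 1)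
  have h : ∀ᵐ x ∂(bernoulliMeasure (1 : ℝ) 0 p), x = 0 ∨ x = 1 := by
    rw [ae_iff]
    refine bernoulliMeasure_apply_of_notMem_of_notMem _ hm.compl ?_ ?_ <;> simp
  exact (hΘ.ae_iff (measurableSet_setOfPred.1 hm)).2 h

theorem integral_of_hasLaw_bernoulli
    (hΘ : HasLaw Θ (bernoulliMeasure (1 : ℝ) 0 p) P) : ∫ w, Θ w ∂P = p := by
  have h := integral_map (f := fun x : ℝ => x) hΘ.aemeasurable
    measurable_id.aestronglyMeasurable
  rw [← h, hΘ.map_eq, integral_bernoulliMeasure]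
  simp

/-- Expectation of a function of two independent Bernoulli variables. -/
theorem integral_bernoulli_pair {V : Type*} [NormedAddCommGroup V] [NormedSpace ℝ V]
    [CompleteSpace V] [IsProbabilityMeasure P]
    (hΘ : HasLaw Θ (bernoulliMeasure (1 : ℝ) 0 p) P)
    (hΘs : HasLaw Θs (bernoulliMeasure (1 : ℝ) 0 p) P) (hind : IndepFun Θ Θs P)
    (f : ℝ → ℝ → V) :
    ∫ w, f (Θ w) (Θs w) ∂P = ((1 - (p : ℝ)) ^ 2) • f 0 0 + ((p : ℝ) * (1 - p)) • f 0 1 +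
      ((p : ℝ) * (1 - p)) • f 1 0 + ((p : ℝ) ^ 2) • f 1 1 := by
  have h01 := ae_eq_zero_or_one_of_hasLaw_bernoulli hΘ
  have h01s := ae_eq_zero_or_one_of_hasLaw_bernoulli hΘs
  have hb : ∀ {X : Ω → ℝ}, HasLaw X (bernoulliMeasure (1 : ℝ) 0 p) P → Integrable X P :=
    fun {X} hX => Integrable.of_bound hX.aemeasurable.aestronglyMeasurable 1 <| by
      filter_upwards [ae_eq_zero_or_one_of_hasLaw_bernoulli hX] with w hw
      rcases hw with hw | hw <;> simp [hw]
  have hi := hb hΘ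
  have his := hb hΘs
  have hprod : Integrable (fun w => Θ w * Θs w) P := hind.integrable_mul hi his
  -- Any function on `{0, 1}²` is a polynomial of degree at most one in each variable. Only the two
  -- means and, by independence, the mean of the product are then needed, and `f` need not be
  -- measurable.
  have heq : ∀ᵐ w ∂P, f (Θ w) (Θs w) = f 0 0 + Θ w • (f 1 0 - f 0 0) + Θs w • (f 0 1 - f 0 0) +
      (Θ w * Θs w) • (f 1 1 - f 1 0 - f 0 1 + f 0 0) := by
    filter_upwards [h01, h01s] with w hw hws
    rcases hw with hw | hw <;> rcases hws with hws | hws <;> simp only [hw, hws] <;> module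
  rw [integral_congr_ae heq, integral_add, integral_add, integral_add, integral_const,
    integral_smul_const, integral_smul_const, integral_smul_const,
    integral_of_hasLaw_bernoulli hΘ, integral_of_hasLaw_bernoulli hΘs]
  · have hE : ∫ w, Θ w * Θs w ∂P = (p : ℝ) * p := by
      have := hind.integral_fun_mul_eq_mul_integral hi.1 his.1
      rw [this, integral_of_hasLaw_bernoulli hΘ, integral_of_hasLaw_bernoulli hΘs]
    rw [hE]
    simp only [probReal_univ]
    module
  all_goals first
    | exact integrable_const _
    | exact hi.smul_const _
    | exact his.smul_const _
    | exact hprod.smul_const _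
    | exact (integrable_const _).add (hi.smul_const _)
    | exact ((integrable_const _).add (hi.smul_const _)).add (his.smul_const _)

theorem integral_field [IsProbabilityMeasure P] {d : ℕ}
    (hΘ : HasLaw Θ (bernoulliMeasure (1 : ℝ) 0 p) P)
    (hΘs : HasLaw Θs (bernoulliMeasure (1 : ℝ) 0 p) P) (hind : IndepFun Θ Θs P)
    (H : E d → E d) (G : Fin d → E d → E d) (a b x y : E d) :
    ∫ w, field H G (Θ w) (Θs w) a b x y ∂P = avgKernel H G (p : ℝ) a b x y := by
  rw [integral_bernoulli_pair hΘ hΘs hind fun θ θs => field H G θ θs a b x y]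
  simp only [field, avgKernel]
  simp
  module

end dynamics

theorem P1.integrable_norm {d : ℕ} (μ : P1 d) : Integrable (fun x => ‖x‖) μ.toMeasure := μ.2.2

/-! ### Time increments and bounds uniform in the scaling -/

section carathéodory

variable {T : ℝ} {f g : ℝ → ℝ}

theorem IsCaratheodoryDerivative.sub_eq (h : IsCaratheodoryDerivative T f g) {s t : ℝ}
    (hs : s ∈ Icc 0 T) (ht : t ∈ Icc 0 T) : f t - f s = ∫ r in s..t, g r := by
  have h0 : ∀ r ∈ Icc 0 T, IntervalIntegrable g volume 0 r := fun r hr =>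
    h.1.mono_set (by
      rw [uIcc_of_le hr.1, uIcc_of_le (hr.1.trans hr.2)]; exact Icc_subset_Icc_right hr.2)
  rw [h.2 t ht, h.2 s hs, ← intervalIntegral.integral_interval_sub_left (h0 t ht) (h0 s hs)]
  ring

theorem IsCaratheodoryDerivative.abs_sub_le (h : IsCaratheodoryDerivative T f g) {B : ℝ}
    (hB : ∀ r ∈ Icc 0 T, |g r| ≤ B) {s t : ℝ} (hs : s ∈ Icc 0 T) (ht : t ∈ Icc 0 T) :
    |f t - f s| ≤ B * |t - s| := by
  rw [h.sub_eq hs ht]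
  refine intervalIntegral.norm_integral_le_of_norm_le_const (f := g) (C := B) fun r hr => hB r ?_
  exact uIcc_subset_Icc hs ht (uIoc_subset_uIcc hr)

end carathéodory

section interaction

variable {d : ℕ} {H : E d → E d} {G : Fin d → E d → E d}

theorem exists_field_bound (hH : IsInteractionKernel H) (hG : ∀ ℓ, IsInteractionKernel (G ℓ))
    {U : Set (E d)} (hU : IsCompact U) :
    ∃ M : ℝ, 0 < M ∧ ∀ θ θs : ℝ, θ = 0 ∨ θ = 1 → θs = 0 ∨ θs = 1 → ∀ u ∈ U, ∀ us ∈ U,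
      ∀ x y, ‖field H G θ θs u us x y‖ ≤ M := by
  obtain ⟨A, hA⟩ := hH.bounded
  choose B hB using fun ℓ => (hG ℓ).bounded
  obtain ⟨ρ, hρ⟩ := hU.isBounded.exists_norm_le
  have hA0 : 0 ≤ A := (norm_nonneg _).trans (hA 0)
  have hB0 : ∀ ℓ, 0 ≤ B ℓ := fun ℓ => (norm_nonneg _).trans (hB ℓ 0)
  -- The summand `1` makes the bound strictly positive; the absolute value covers an empty `U`, for
  -- which `ρ` may be negative.
  refine ⟨A + ∑ ℓ, |ρ| * B ℓ + |ρ| + 1, ?_, fun θ θs hθ hθs u hu us hus x y => ?_⟩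
  · have : 0 ≤ ∑ ℓ, |ρ| * B ℓ := Finset.sum_nonneg fun ℓ _ => mul_nonneg (abs_nonneg _) (hB0 ℓ)
    have := abs_nonneg ρ
    linarith
  have hu' := (hρ u hu).trans (le_abs_self ρ)
  have hus' := (hρ us hus).trans (le_abs_self ρ)
  have h1 : |(1 - θ) * (1 - θs)| ≤ 1 := by
    rcases hθ with rfl | rfl <;> rcases hθs with rfl | rfl <;> norm_num
  have h2 : |(1 - θ) * θs| ≤ 1 := by
    rcases hθ with rfl | rfl <;> rcases hθs with rfl | rfl <;> norm_num
  have h3 : |θ| ≤ 1 := by rcases hθ with rfl | rfl <;> norm_num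
  have e1 : ‖((1 - θ) * (1 - θs)) • H (x - y)‖ ≤ A := by
    rw [norm_smul, Real.norm_eq_abs]
    exact (mul_le_of_le_one_left (norm_nonneg _) h1).trans (hA _)
  have e2 : ‖∑ ℓ, (us ℓ * ((1 - θ) * θs)) • G ℓ (x - y)‖ ≤ ∑ ℓ, |ρ| * B ℓ := by
    refine norm_sum_le_of_le _ fun ℓ _ => ?_
    rw [norm_smul, norm_mul, Real.norm_eq_abs ((1 - θ) * θs)]
    refine mul_le_mul ?_ (hB ℓ _) (norm_nonneg _) (abs_nonneg _)
    exact (mul_le_of_le_one_right (norm_nonneg _) h2).trans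
      ((PiLp.norm_apply_le us ℓ).trans hus')
  have e3 : ‖θ • u‖ ≤ |ρ| := by
    rw [norm_smul, Real.norm_eq_abs]
    exact (mul_le_of_le_one_left (norm_nonneg _) h3).trans hu'
  have := norm_add₃_le (a := ((1 - θ) * (1 - θs)) • H (x - y))
    (b := ∑ ℓ, (us ℓ * ((1 - θ) * θs)) • G ℓ (x - y)) (c := θ • u)
  unfold field
  linarith

variable {Ω : Type*} [MeasurableSpace Ω] {P : Measure Ω} [IsProbabilityMeasure P] {Θ Θs : Ω → ℝ}

/-- The factor `α` gained from a jump of length at most `α * M` cancels the frequency `1 / α`. The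
weight `g` is a constant for Lipschitz estimates and a multiple of the norm for tail estimates. -/
theorem abs_collision_le (hΘ : ∀ᵐ w ∂P, Θ w = 0 ∨ Θ w = 1) (hΘs : ∀ᵐ w ∂P, Θs w = 0 ∨ Θs w = 1)
    {M : ℝ} {u us : E d} (hM : ∀ θ θs : ℝ, θ = 0 ∨ θ = 1 → θs = 0 ∨ θs = 1 →
      ∀ x y, ‖field H G θ θs u us x y‖ ≤ M) {α : ℝ} (hα : 0 < α) (ν : P1 d) {φ g : E d → ℝ}
    (hg : Integrable g ν.toMeasure)
    (hφg : ∀ x h, ‖h‖ ≤ α * M → |φ (x + h) - φ x| ≤ α * g x) :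
    |collision P Θ Θs H G α (1 / α) u us ν φ| ≤ ∫ x, g x ∂ν.toMeasure := by
  rw [collision, abs_mul, abs_of_pos (one_div_pos.2 hα), one_div_mul_eq_div, div_le_iff₀' hα]
  have hconst : ∀ {X : Type _} [MeasurableSpace X] {ρ : Measure X} [IsProbabilityMeasure ρ]
      {F : X → ℝ} {C : ℝ}, (∀ᵐ x ∂ρ, ‖F x‖ ≤ C) → ‖∫ x, F x ∂ρ‖ ≤ C := fun h => by
    simpa using norm_integral_le_of_norm_le_const h
  rw [← Real.norm_eq_abs]
  have := norm_integral_le_of_norm_le_const (μ := P) (f := fun w => ∫ y, (∫ x,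
    (φ (postState H G α (Θ w) (Θs w) u us x y) - φ x) ∂ν.toMeasure) ∂ν.toMeasure)
    (C := α * ∫ x, g x ∂ν.toMeasure) ?_
  · simpa using this
  filter_upwards [hΘ, hΘs] with w hw hws
  refine hconst (Eventually.of_forall fun y => ?_)
  rw [← integral_const_mul]
  refine norm_integral_le_of_norm_le (hg.const_mul α) (Eventually.of_forall fun x => ?_)
  refine hφg x _ ?_
  rw [norm_smul, Real.norm_of_nonneg hα.le]
  exact mul_le_mul_of_nonneg_left (hM _ _ hw hws x y) hα.le

end interaction

/-! ### Moments and tails along the scaled dynamics -/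

/-- Truncated radial weights are limits of constants minus test functions. -/
theorem integral_norm_sub_pos_le {d : ℕ} (μ ν : P1 d) {R C : ℝ}
    (h : ∀ φ : E d → ℝ, IsTestFunction φ → (∀ x y, |φ x - φ y| ≤ ‖x - y‖) →
      (∃ c, ∀ x, ‖x‖ ≤ R - 1 → φ x = c) →
      |∫ x, φ x ∂ν.toMeasure - ∫ x, φ x ∂μ.toMeasure| ≤ C) :
    ∫ x, max 0 (‖x‖ - R) ∂ν.toMeasure ≤ ∫ x, max 0 (‖x‖ - R) ∂μ.toMeasure + C := by
  have hcont : ∀ N : ℝ, Continuous fun x : E d => min N (max 0 (‖x‖ - R)) := fun N => by fun_prop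
  have hb : ∀ (N : ℝ) (x : E d), ‖min N (max 0 (‖x‖ - R))‖ ≤ |N| := fun N x => by
    rw [Real.norm_eq_abs, abs_le]
    have h0 : 0 ≤ max 0 (‖x‖ - R) := le_max_left _ _
    refine ⟨le_min (neg_abs_le N) ((neg_nonpos.2 (abs_nonneg N)).trans h0),
      (min_le_left _ _).trans (le_abs_self N)⟩
  have hint : ∀ (N : ℝ) (ρ : P1 d), Integrable (fun x => min N (max 0 (‖x‖ - R))) ρ.toMeasure :=
    fun N ρ => Integrable.of_bound (hcont N).aestronglyMeasurable |N| (Eventually.of_forall (hb N))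
  have hint' : ∀ ρ : P1 d, Integrable (fun x => max 0 (‖x‖ - R)) ρ.toMeasure := fun ρ => by
    simpa [max_comm] using (ρ.integrable_norm.sub (integrable_const R)).pos_part
  have htrunc : ∀ N : ℕ, ∫ x, min (N : ℝ) (max 0 (‖x‖ - R)) ∂ν.toMeasure ≤
      ∫ x, max 0 (‖x‖ - R) ∂μ.toMeasure + C := by
    intro N
    -- Mollification at scale `δ` costs at most `δ` under each of the two measures, whence `2 * δ`.
    suffices hδ : ∀ δ : ℝ, 0 < δ → δ ≤ 1 → ∫ x, min (N : ℝ) (max 0 (‖x‖ - R)) ∂ν.toMeasure ≤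
        ∫ x, min (N : ℝ) (max 0 (‖x‖ - R)) ∂μ.toMeasure + C + 2 * δ by
      have h1 : ∫ x, min (N : ℝ) (max 0 (‖x‖ - R)) ∂μ.toMeasure ≤
          ∫ x, max 0 (‖x‖ - R) ∂μ.toMeasure :=
        integral_mono (hint _ _) (hint' _) fun x => min_le_right _ _
      refine le_of_forall_pos_le_add fun η hη => ?_
      have h2 := hδ (min (η / 2) 1) (by positivity) (min_le_right _ _)
      have h3 := min_le_left (η / 2) 1
      linarith
    intro δ hδ hδ1
    -- Subtracting the truncated weight from its maximum gives compact support; the constant cancels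
    -- in the difference of the integrals since both measures are probabilities.
    set f : E d → ℝ := fun x => N - min (N : ℝ) (max 0 (‖x‖ - R)) with hf
    have hlip : LipschitzWith 1 f := by
      refine LipschitzWith.of_dist_le_mul fun x y => ?_
      rw [NNReal.coe_one, one_mul, Real.dist_eq, dist_eq_norm, hf]
      simp only [sub_sub_sub_cancel_left]
      have h1 := abs_min_sub_min_le_max (N : ℝ) (max 0 (‖y‖ - R)) N (max 0 (‖x‖ - R))
      have h2 := abs_max_sub_max_le_max 0 (‖y‖ - R) 0 (‖x‖ - R)
      rw [sub_self, abs_zero,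
        max_eq_right (abs_nonneg (max 0 (‖y‖ - R) - max 0 (‖x‖ - R)))] at h1
      rw [sub_self, abs_zero, max_eq_right (abs_nonneg (‖y‖ - R - (‖x‖ - R))),
        sub_sub_sub_cancel_right] at h2
      exact h1.trans (h2.trans (by rw [abs_sub_comm]; exact abs_norm_sub_norm_le x y))
    have hsupp : HasCompactSupport f := by
      refine HasCompactSupport.intro (isCompact_closedBall (0 : E d) (N + R)) fun x hx => ?_
      rw [Metric.mem_closedBall, dist_zero_right, not_le] at hx
      rw [hf]
      simp only
      rw [min_eq_left ((by linarith : (N : ℝ) ≤ ‖x‖ - R).trans (le_max_right _ _)), sub_self]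
    obtain ⟨φ, hφ, hφlip, hφf, hφc⟩ := exists_isTestFunction_approx hlip hsupp hδ
    have hconst : ∀ z : E d, ‖z‖ ≤ R → f z = N := fun z hz => by
      rw [hf]
      simp only
      rw [max_eq_left (by linarith), min_eq_right (Nat.cast_nonneg N), sub_zero]
    -- `f` equals `N` on the ball of radius `R`, so averaging at scale `δ ≤ 1` leaves it equal to
    -- `N` on the ball of radius `R - 1`.
    have hmain := h φ hφ hφlip ⟨N, fun x hx => by
      rw [hφc x fun z hz => ?_, hconst x (by linarith)]
      rw [hconst x (by linarith), hconst z]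
      have := norm_sub_norm_le z x
      linarith⟩
    have hfint : ∀ ρ : P1 d, Integrable f ρ.toMeasure := fun ρ =>
      (integrable_const _).sub (hint N ρ)
    have hfval : ∀ ρ : P1 d, ∫ x, f x ∂ρ.toMeasure =
        N - ∫ x, min (N : ℝ) (max 0 (‖x‖ - R)) ∂ρ.toMeasure := fun ρ => by
      rw [hf, integral_sub (integrable_const _) (hint N ρ)]
      simp
    have hclose : ∀ ρ : P1 d, |∫ x, φ x ∂ρ.toMeasure - ∫ x, f x ∂ρ.toMeasure| ≤ δ := fun ρ => by
      rw [← integral_sub (hφ.integrable _) (hfint ρ), ← Real.norm_eq_abs]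
      simpa using norm_integral_le_of_norm_le_const (μ := ρ.toMeasure)
        (f := fun x => φ x - f x) (C := δ) (Eventually.of_forall hφf)
    have h1 := abs_le.1 (hclose μ)
    have h2 := abs_le.1 (hclose ν)
    have h3 := abs_le.1 hmain
    rw [hfval] at h1 h2
    linarith [h1.1, h1.2, h2.1, h2.2, h3.1, h3.2]
  refine le_of_tendsto' (tendsto_integral_of_dominated_convergence
    (fun x => max 0 (‖x‖ - R)) (fun N => (hcont N).aestronglyMeasurable) (hint' ν)
    (fun N => Eventually.of_forall fun x => ?_) (Eventually.of_forall fun x => ?_)) htrunc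
  · have h0 : 0 ≤ max 0 (‖x‖ - R) := le_max_left _ _
    rw [Real.norm_of_nonneg (le_min (Nat.cast_nonneg N) h0)]
    exact min_le_right _ _
  · obtain ⟨n, hn⟩ := exists_nat_ge (max 0 (‖x‖ - R))
    refine tendsto_const_nhds.congr' ?_
    filter_upwards [eventually_ge_atTop n] with k hk
    rw [min_eq_right (hn.trans (Nat.cast_le.2 hk))]

/-- Beyond radius `2 * R` one has `‖x‖ ≤ 2 * (‖x‖ - R)`. -/
theorem lintegral_tail_le {d : ℕ} (μ : P1 d) (R : ℝ) :
    ∫⁻ x in {x | 2 * R < ‖x‖}, ‖x‖ₑ ∂μ.toMeasure ≤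
      ENNReal.ofReal (2 * ∫ x, max 0 (‖x‖ - R) ∂μ.toMeasure) := by
  have hint : Integrable (fun x => max 0 (‖x‖ - R)) μ.toMeasure := by
    simpa [max_comm] using (μ.integrable_norm.sub (integrable_const R)).pos_part
  rw [← integral_const_mul, ofReal_integral_eq_lintegral_ofReal (hint.const_mul 2)
    (Eventually.of_forall fun x => mul_nonneg zero_le_two (le_max_left _ _)),
    ← lintegral_indicator (measurableSet_lt measurable_const measurable_norm)]
  refine lintegral_mono fun x => ?_
  by_cases hx : 2 * R < ‖x‖
  · rw [indicator_of_mem (by exact hx), ← ofReal_norm]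
    refine ENNReal.ofReal_le_ofReal ?_
    have := le_max_right 0 (‖x‖ - R)
    linarith
  · rw [indicator_of_notMem (by exact hx)]
    exact zero_le

section moments

variable {d : ℕ} {H : E d → E d} {G : Fin d → E d → E d} {Ω : Type*} [MeasurableSpace Ω]
  {P : Measure Ω} [IsProbabilityMeasure P] {Θ Θs : Ω → ℝ} {T α M : ℝ} {u us : ℝ → E d} {μ₀ : P1 d}
  {μ : ℝ → P1 d}

theorem IsBoltzmannWeakSolution.abs_integral_sub_le
    (hμ : IsBoltzmannWeakSolution P Θ Θs H G T α (1 / α) u us μ₀ μ)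
    (hΘ : ∀ᵐ w ∂P, Θ w = 0 ∨ Θ w = 1) (hΘs : ∀ᵐ w ∂P, Θs w = 0 ∨ Θs w = 1) (hα : 0 < α)
    (hM : ∀ θ θs : ℝ, θ = 0 ∨ θ = 1 → θs = 0 ∨ θs = 1 → ∀ t ∈ Icc 0 T, ∀ x y,
      ‖field H G θ θs (u t) (us t) x y‖ ≤ M)
    {φ g : E d → ℝ} (hφ : IsTestFunction φ) (hg : ∀ t ∈ Icc 0 T, Integrable g (μ t).toMeasure)
    (hφg : ∀ x h, ‖h‖ ≤ α * M → |φ (x + h) - φ x| ≤ α * g x) {B : ℝ}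
    (hB : ∀ t ∈ Icc 0 T, ∫ x, g x ∂(μ t).toMeasure ≤ B) {s t : ℝ} (hs : s ∈ Icc 0 T)
    (ht : t ∈ Icc 0 T) :
    |∫ x, φ x ∂(μ t).toMeasure - ∫ x, φ x ∂(μ s).toMeasure| ≤ B * |t - s| :=
  (hμ.weak_form φ hφ).abs_sub_le (fun r hr => (abs_collision_le hΘ hΘs
    (fun θ θs hθ hθs => hM θ θs hθ hθs r hr) hα (μ r) (hg r hr) hφg).trans (hB r hr)) hs ht

theorem IsBoltzmannWeakSolution.abs_integral_sub_le_of_lipschitz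
    (hμ : IsBoltzmannWeakSolution P Θ Θs H G T α (1 / α) u us μ₀ μ)
    (hΘ : ∀ᵐ w ∂P, Θ w = 0 ∨ Θ w = 1) (hΘs : ∀ᵐ w ∂P, Θs w = 0 ∨ Θs w = 1) (hα : 0 < α)
    (hM : ∀ θ θs : ℝ, θ = 0 ∨ θ = 1 → θs = 0 ∨ θs = 1 → ∀ t ∈ Icc 0 T, ∀ x y,
      ‖field H G θ θs (u t) (us t) x y‖ ≤ M)
    {φ : E d → ℝ} (hφ : IsTestFunction φ) {L : ℝ} (hL0 : 0 ≤ L)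
    (hL : ∀ x y, |φ x - φ y| ≤ L * ‖x - y‖) {s t : ℝ} (hs : s ∈ Icc 0 T) (ht : t ∈ Icc 0 T) :
    |∫ x, φ x ∂(μ t).toMeasure - ∫ x, φ x ∂(μ s).toMeasure| ≤ L * M * |t - s| := by
  refine hμ.abs_integral_sub_le hΘ hΘs hα hM hφ (g := fun _ => L * M)
    (fun _ _ => integrable_const _) (fun x h hh => ?_) (fun _ _ => by simp) hs ht
  refine (hL _ _).trans ?_
  rw [add_sub_cancel_left]
  nlinarith [mul_le_mul_of_nonneg_left hh hL0]

theorem IsBoltzmannWeakSolution.integral_norm_le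
    (hμ : IsBoltzmannWeakSolution P Θ Θs H G T α (1 / α) u us μ₀ μ)
    (hΘ : ∀ᵐ w ∂P, Θ w = 0 ∨ Θ w = 1) (hΘs : ∀ᵐ w ∂P, Θs w = 0 ∨ Θs w = 1) (hα : 0 < α)
    (hM0 : 0 < M)
    (hM : ∀ θ θs : ℝ, θ = 0 ∨ θ = 1 → θs = 0 ∨ θs = 1 → ∀ t ∈ Icc 0 T, ∀ x y,
      ‖field H G θ θs (u t) (us t) x y‖ ≤ M) {t : ℝ} (ht : t ∈ Icc 0 T) :
    ∫ x, ‖x‖ ∂(μ t).toMeasure ≤ ∫ x, ‖x‖ ∂μ₀.toMeasure + M * T := by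
  -- With `R = 0` the weight is the norm itself, and the Lipschitz estimate with constant `1`
  -- suffices.
  have h := integral_norm_sub_pos_le (μ 0) (μ t) (R := 0) (C := M * T) fun φ hφ hL _ => by
    have := hμ.abs_integral_sub_le_of_lipschitz hΘ hΘs hα hM hφ zero_le_one
      (fun x y => by simpa using hL x y) (left_mem_Icc.2 (ht.1.trans ht.2)) ht
    refine this.trans ?_
    rw [one_mul, sub_zero, abs_of_nonneg ht.1]
    exact mul_le_mul_of_nonneg_left ht.2 hM0.le
  simpa [hμ.initial] using h

/-- A test function constant on the ball of radius `R - 1` does not see jumps of length at most `1`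
that start in the ball of radius `R - 2`. Outside that ball `‖x‖ / (R - 2) ≥ 1`, so the increment is
at most `α * (M / (R - 2) * ‖x‖)`, and the first moment bound makes the growth of the tail of order
`1 / R`. -/
theorem IsBoltzmannWeakSolution.integral_tail_le
    (hμ : IsBoltzmannWeakSolution P Θ Θs H G T α (1 / α) u us μ₀ μ)
    (hΘ : ∀ᵐ w ∂P, Θ w = 0 ∨ Θ w = 1) (hΘs : ∀ᵐ w ∂P, Θs w = 0 ∨ Θs w = 1) (hα : 0 < α)
    (hM0 : 0 < M) (hαM : α * M ≤ 1)
    (hM : ∀ θ θs : ℝ, θ = 0 ∨ θ = 1 → θs = 0 ∨ θs = 1 → ∀ t ∈ Icc 0 T, ∀ x y,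
      ‖field H G θ θs (u t) (us t) x y‖ ≤ M) {t : ℝ} (ht : t ∈ Icc 0 T) {R : ℝ} (hR : 2 < R) :
    ∫ x, max 0 (‖x‖ - R) ∂(μ t).toMeasure ≤ ∫ x, max 0 (‖x‖ - R) ∂μ₀.toMeasure +
      M / (R - 2) * (∫ x, ‖x‖ ∂μ₀.toMeasure + M * T) * T := by
  have hR' : 0 < R - 2 := by linarith
  have h := integral_norm_sub_pos_le (μ 0) (μ t) (R := R)
    (C := M / (R - 2) * (∫ x, ‖x‖ ∂μ₀.toMeasure + M * T) * T) fun φ hφ hL hc => by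
      obtain ⟨c, hc⟩ := hc
      have := hμ.abs_integral_sub_le hΘ hΘs hα hM hφ (g := fun x => M / (R - 2) * ‖x‖)
        (fun r _ => (μ r).integrable_norm.const_mul _) (fun x h hh => ?_)
        (B := M / (R - 2) * (∫ x, ‖x‖ ∂μ₀.toMeasure + M * T)) (fun r hr => ?_)
        (left_mem_Icc.2 (ht.1.trans ht.2)) ht
      · refine this.trans ?_
        rw [sub_zero, abs_of_nonneg ht.1]
        refine mul_le_mul_of_nonneg_left ht.2 (mul_nonneg (div_pos hM0 hR').le ?_)
        exact add_nonneg (integral_nonneg fun x => norm_nonneg _)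
          (mul_nonneg hM0.le (ht.1.trans ht.2))
      · rcases le_total ‖x‖ (R - 2) with hx | hx
        · have h2 : ‖x + h‖ ≤ R - 1 := by linarith [norm_add_le x h]
          rw [hc x (by linarith), hc _ h2, sub_self, abs_zero]
          positivity
        · refine (hL _ _).trans ?_
          rw [add_sub_cancel_left]
          refine hh.trans (mul_le_mul_of_nonneg_left ?_ hα.le)
          rw [div_mul_eq_mul_div, le_div_iff₀ hR']
          exact mul_le_mul_of_nonneg_left hx hM0.le
      · rw [integral_const_mul]
        exact mul_le_mul_of_nonneg_left (hμ.integral_norm_le hΘ hΘs hα hM0 hM hr)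
          (div_pos hM0 hR').le
  rwa [hμ.initial] at h

end moments

/-! ### Taylor expansion and the grazing limit -/

section taylor

variable {d : ℕ} {φ : E d → ℝ}

theorem IsTestFunction.differentiable (hφ : IsTestFunction φ) : Differentiable ℝ φ :=
  hφ.1.differentiable (by simp)

theorem IsTestFunction.continuous_fderiv (hφ : IsTestFunction φ) : Continuous (fderiv ℝ φ) :=
  hφ.1.continuous_fderiv (by simp)

theorem IsTestFunction.exists_lipschitz_bound (hφ : IsTestFunction φ) :
    ∃ L : ℝ, 0 ≤ L ∧ (∀ x, ‖fderiv ℝ φ x‖ ≤ L) ∧ ∀ x y, |φ x - φ y| ≤ L * ‖x - y‖ := by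
  obtain ⟨L, hL⟩ := ContDiff.lipschitzWith_of_hasCompactSupport hφ.2 hφ.1 (by simp)
  refine ⟨L, L.2, fun x => norm_fderiv_le_of_lipschitz ℝ hL, fun x y => ?_⟩
  rw [← Real.dist_eq, ← dist_eq_norm]
  exact hL.dist_le_mul x y

/-- The derivative is `C¹` with compact support, hence Lipschitz; the mean value inequality on the
ball of radius `‖h‖` around `x` gives the quadratic remainder. -/
theorem IsTestFunction.exists_taylor_bound (hφ : IsTestFunction φ) :
    ∃ C : ℝ, 0 ≤ C ∧ ∀ x h, |φ (x + h) - φ x - fderiv ℝ φ x h| ≤ C * ‖h‖ ^ 2 := by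
  have h1 : ContDiff ℝ 1 (fderiv ℝ φ) := hφ.1.fderiv_right (m := 1) (by
    rw [one_add_one_eq_two]; exact WithTop.coe_le_coe.2 le_top)
  obtain ⟨C, hC⟩ := ContDiff.lipschitzWith_of_hasCompactSupport (hφ.2.fderiv ℝ) h1 (by simp)
  refine ⟨C, C.2, fun x h => ?_⟩
  have key := (convex_closedBall x ‖h‖).norm_image_sub_le_of_norm_fderiv_le' (𝕜 := ℝ) (f := φ)
    (φ := fderiv ℝ φ x) (C := C * ‖h‖) (x := x) (y := x + h)
    (fun z _ => hφ.differentiable z) (fun z hz => ?_) (Metric.mem_closedBall_self (norm_nonneg _))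
    (by simp)
  · rw [add_sub_cancel_left] at key
    rw [pow_two, ← mul_assoc]
    exact key
  · have h2 := hC.dist_le_mul z x
    rw [dist_eq_norm] at h2
    exact h2.trans (mul_le_mul_of_nonneg_left (Metric.mem_closedBall.1 hz) C.2)

end taylor

section limit

variable {d : ℕ} {H : E d → E d} {G : Fin d → E d → E d}

theorem continuous_field (hH : IsInteractionKernel H) (hG : ∀ ℓ, IsInteractionKernel (G ℓ))
    (θ θs : ℝ) (u us : E d) : Continuous fun z : E d × E d => field H G θ θs u us z.1 z.2 := by
  have h1 := hH.locallyLipschitz.continuous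
  have h2 := fun ℓ => (hG ℓ).locallyLipschitz.continuous
  unfold field
  fun_prop

/-- Controls converging to a limit make the interaction fields converge uniformly. -/
theorem exists_field_sub_bound (hG : ∀ ℓ, IsInteractionKernel (G ℓ)) {u us : ℕ → E d}
    {ub usb : E d} (hu : Tendsto u atTop (𝓝 ub)) (hus : Tendsto us atTop (𝓝 usb)) (θ θs : ℝ) :
    ∃ η : ℕ → ℝ, Tendsto η atTop (𝓝 0) ∧ ∀ n x y,
      ‖field H G θ θs (u n) (us n) x y - field H G θ θs ub usb x y‖ ≤ η n := by
  choose B hB using fun ℓ => (hG ℓ).bounded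
  refine ⟨fun n => ∑ ℓ, |(us n ℓ - usb ℓ) * ((1 - θ) * θs)| * B ℓ + ‖θ • (u n - ub)‖, ?_,
    fun n x y => ?_⟩
  · have hz : (0 : ℝ) = ∑ ℓ, |(usb ℓ - usb ℓ) * ((1 - θ) * θs)| * B ℓ + ‖θ • (ub - ub)‖ := by simp
    rw [hz]
    have hus' : ∀ ℓ, Tendsto (fun n => us n ℓ) atTop (𝓝 (usb ℓ)) := fun ℓ =>
      ((EuclideanSpace.proj (𝕜 := ℝ) ℓ).continuous.tendsto usb).comp hus
    exact (tendsto_finsetSum _ fun ℓ _ => ((((hus' ℓ).sub_const _).mul_const _).abs.mul_const _)).add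
      (((hu.sub_const _).const_smul θ).norm)
  · have heq : field H G θ θs (u n) (us n) x y - field H G θ θs ub usb x y =
        ∑ ℓ, ((us n ℓ - usb ℓ) * ((1 - θ) * θs)) • G ℓ (x - y) + θ • (u n - ub) := by
      simp only [field, sub_mul, sub_smul, Finset.sum_sub_distrib, smul_sub]
      abel
    rw [heq]
    refine (norm_add_le _ _).trans (add_le_add (norm_sum_le_of_le _ fun ℓ _ => ?_) le_rfl)
    rw [norm_smul, Real.norm_eq_abs]
    exact mul_le_mul_of_nonneg_left (hB ℓ _) (abs_nonneg _)

/-- Integrals over product measures converge for uniformly converging integrands. -/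
theorem tendsto_integral_prod_of_uniform {X : Type*} [TopologicalSpace X]
    [SecondCountableTopology X] [TopologicalSpace.PseudoMetrizableSpace X] [MeasurableSpace X]
    [BorelSpace X] {ν : ℕ → ProbabilityMeasure X} {ν₀ : ProbabilityMeasure X}
    (hν : Tendsto ν atTop (𝓝 ν₀)) {f : ℕ → X × X → ℝ} {g : X × X → ℝ} (hf : ∀ n, Continuous (f n))
    (hg : Continuous g) {B : ℝ} (hB : ∀ z, |g z| ≤ B) {c : ℕ → ℝ} (hc : Tendsto c atTop (𝓝 0))
    (hfg : ∀ n z, |f n z - g z| ≤ c n) :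
    Tendsto (fun n => ∫ z, f n z ∂((ν n : Measure X).prod (ν n))) atTop
      (𝓝 (∫ z, g z ∂((ν₀ : Measure X).prod ν₀))) := by
  have hprod : Tendsto (fun n => (ν n).prod (ν n)) atTop (𝓝 (ν₀.prod ν₀)) :=
    (ProbabilityMeasure.continuous_prod.tendsto (ν₀, ν₀)).comp (hν.prodMk_nhds hν)
  have h1 := ProbabilityMeasure.tendsto_iff_forall_integral_tendsto.1 hprod
    (BoundedContinuousFunction.ofNormedAddCommGroup g hg B hB)
  simp only [BoundedContinuousFunction.coe_ofNormedAddCommGroup,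
    ProbabilityMeasure.toMeasure_prod] at h1
  have hgi : ∀ n, Integrable g ((ν n : Measure X).prod (ν n)) := fun n =>
    Integrable.of_bound hg.aestronglyMeasurable B (Eventually.of_forall hB)
  have hfi : ∀ n, Integrable (f n) ((ν n : Measure X).prod (ν n)) := fun n =>
    Integrable.of_bound (hf n).aestronglyMeasurable (c n + B) (Eventually.of_forall fun z => by
      have h2 := abs_add_le (f n z - g z) (g z)
      rw [sub_add_cancel] at h2
      exact h2.trans (add_le_add (hfg n z) (hB z)))
  have h2 : Tendsto (fun n => ∫ z, f n z ∂((ν n : Measure X).prod (ν n)) -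
      ∫ z, g z ∂((ν n : Measure X).prod (ν n))) atTop (𝓝 0) := by
    refine squeeze_zero_norm (fun n => ?_) hc
    rw [← integral_sub (hfi n) (hgi n)]
    simpa using norm_integral_le_of_norm_le_const (μ := (ν n : Measure X).prod (ν n))
      (f := fun z => f n z - g z) (C := c n) (Eventually.of_forall (hfg n))
  simpa using h2.add h1

variable {ε : ℕ → ℝ} {u us : ℕ → E d} {ub usb : E d} {ν : ℕ → P1 d} {ν₀ : P1 d} {φ : E d → ℝ}

/-- With the indicators frozen, the difference quotient converges uniformly on pairs of states: the
Taylor remainder contributes `C * M ^ 2 * ε n`, the moving controls `L * η n`. Weak convergence of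
the product measures handles the limiting integrand, which is bounded and continuous. -/
theorem tendsto_scaled_collision_of_indicators (hH : IsInteractionKernel H)
    (hG : ∀ ℓ, IsInteractionKernel (G ℓ)) (hε : ∀ n, 0 < ε n) (hε0 : Tendsto ε atTop (𝓝 0))
    (hu : Tendsto u atTop (𝓝 ub)) (hus : Tendsto us atTop (𝓝 usb))
    (hν : Tendsto (fun n => (ν n).toProbabilityMeasure) atTop (𝓝 ν₀.toProbabilityMeasure))
    {M : ℝ} {θ θs : ℝ} (hM : ∀ n x y, ‖field H G θ θs (u n) (us n) x y‖ ≤ M)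
    (hMb : ∀ x y, ‖field H G θ θs ub usb x y‖ ≤ M) (hφ : IsTestFunction φ) :
    Tendsto (fun n => 1 / ε n * ∫ y, (∫ x, (φ (postState H G (ε n) θ θs (u n) (us n) x y) - φ x)
        ∂(ν n).toMeasure) ∂(ν n).toMeasure) atTop
      (𝓝 (∫ z, fderiv ℝ φ z.1 (field H G θ θs ub usb z.1 z.2)
        ∂(ν₀.toMeasure.prod ν₀.toMeasure))) := by
  obtain ⟨L, hL0, hL, -⟩ := hφ.exists_lipschitz_bound
  obtain ⟨C, hC0, hC⟩ := hφ.exists_taylor_bound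
  obtain ⟨η, hη, hηb⟩ := exists_field_sub_bound (H := H) hG hu hus θ θs
  have hM0 : 0 ≤ M := (norm_nonneg _).trans (hMb 0 0)
  have hcf := continuous_field hH hG θ θs
  have hcont : ∀ n, Continuous fun z : E d × E d =>
      1 / ε n * (φ (postState H G (ε n) θ θs (u n) (us n) z.1 z.2) - φ z.1) := fun n => by
    have h1 := hφ.1.continuous
    have h2 := hcf (u n) (us n)
    unfold postState
    fun_prop
  have hcontb : Continuous fun z : E d × E d => fderiv ℝ φ z.1 (field H G θ θs ub usb z.1 z.2) :=
    (hφ.continuous_fderiv.comp continuous_fst).clm_apply (hcf ub usb)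
  have hc : Tendsto (fun n => C * M ^ 2 * ε n + L * η n) atTop (𝓝 0) := by
    simpa using (hε0.const_mul (C * M ^ 2)).add (hη.const_mul L)
  have hclose : ∀ n (z : E d × E d),
      |1 / ε n * (φ (postState H G (ε n) θ θs (u n) (us n) z.1 z.2) - φ z.1) -
        fderiv ℝ φ z.1 (field H G θ θs ub usb z.1 z.2)| ≤ C * M ^ 2 * ε n + L * η n := by
    rintro n ⟨x, y⟩
    simp only
    set k := field H G θ θs (u n) (us n) x y with hk
    set k' := field H G θ θs ub usb x y with hk'
    have h1 := hC x (ε n • k)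
    rw [map_smul, smul_eq_mul, norm_smul, Real.norm_of_nonneg (hε n).le] at h1
    have h2 : |fderiv ℝ φ x (k - k')| ≤ L * η n :=
      (ContinuousLinearMap.le_of_opNorm_le _ (hL x) _).trans
        (mul_le_mul_of_nonneg_left (hηb n x y) hL0)
    have h3 : 1 / ε n * (φ (postState H G (ε n) θ θs (u n) (us n) x y) - φ x) - fderiv ℝ φ x k' =
        1 / ε n * (φ (x + ε n • k) - φ x - ε n * fderiv ℝ φ x k) + fderiv ℝ φ x (k - k') := by
      rw [postState, ← hk, map_sub]
      field_simp [(hε n).ne']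
      ring
    rw [h3]
    refine (abs_add_le _ _).trans (add_le_add ?_ h2)
    rw [abs_mul, abs_of_pos (one_div_pos.2 (hε n)), one_div_mul_eq_div, div_le_iff₀ (hε n)]
    refine h1.trans ?_
    have h4 : ‖k‖ ^ 2 ≤ M ^ 2 := pow_le_pow_left₀ (norm_nonneg _) (hM n x y) 2
    calc C * (ε n * ‖k‖) ^ 2 = C * ε n ^ 2 * ‖k‖ ^ 2 := by ring
      _ ≤ C * ε n ^ 2 * M ^ 2 := mul_le_mul_of_nonneg_left h4 (by positivity)
      _ = C * M ^ 2 * ε n * ε n := by ring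
  have hBb : ∀ z : E d × E d, |fderiv ℝ φ z.1 (field H G θ θs ub usb z.1 z.2)| ≤ L * M := fun z =>
    (ContinuousLinearMap.le_of_opNorm_le _ (hL z.1) _).trans
      (mul_le_mul_of_nonneg_left (hMb _ _) hL0)
  refine (tendsto_integral_prod_of_uniform hν hcont hcontb hBb hc hclose).congr fun n => ?_
  have hint : Integrable (fun z : E d × E d =>
      1 / ε n * (φ (postState H G (ε n) θ θs (u n) (us n) z.1 z.2) - φ z.1))
      ((ν n).toMeasure.prod (ν n).toMeasure) :=
    Integrable.of_bound (hcont n).aestronglyMeasurable (C * M ^ 2 * ε n + L * η n + L * M)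
      (Eventually.of_forall fun z => by
        have h2 := abs_add_le (1 / ε n * (φ (postState H G (ε n) θ θs (u n) (us n) z.1 z.2) - φ z.1)
          - fderiv ℝ φ z.1 (field H G θ θs ub usb z.1 z.2))
          (fderiv ℝ φ z.1 (field H G θ θs ub usb z.1 z.2))
        rw [sub_add_cancel] at h2
        exact h2.trans (add_le_add (hclose n z) (hBb z)))
  -- The symmetric form of Fubini is required, since `collision` integrates first in `x` and then in
  -- `y`.
  refine (integral_prod_symm _ hint).trans ?_
  simp only [integral_const_mul]

variable {Ω : Type*} [MeasurableSpace Ω] {P : Measure Ω} [IsProbabilityMeasure P] {Θ Θs : Ω → ℝ}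
  {p : unitInterval}

theorem avgKernel_eq_sum_field (q : ℝ) (a b x y : E d) : avgKernel H G q a b x y =
    ((1 - q) ^ 2) • field H G 0 0 a b x y + (q * (1 - q)) • field H G 0 1 a b x y +
      (q * (1 - q)) • field H G 1 0 a b x y + (q ^ 2) • field H G 1 1 a b x y := by
  simp only [field, avgKernel]
  simp
  module

/-- The averaged drift tested against a gradient, split over the values of the indicators. -/
theorem integral_inner_avgKernel_eq (hH : IsInteractionKernel H)
    (hG : ∀ ℓ, IsInteractionKernel (G ℓ)) {M : ℝ}
    (hMb : ∀ θ θs : ℝ, θ = 0 ∨ θ = 1 → θs = 0 ∨ θs = 1 → ∀ x y,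
      ‖field H G θ θs ub usb x y‖ ≤ M) (hφ : IsTestFunction φ) (q : ℝ) (ν₀ : P1 d) :
    ∫ x, inner ℝ (∇ φ x) (∫ y, avgKernel H G q ub usb x y ∂ν₀.toMeasure) ∂ν₀.toMeasure =
      (1 - q) ^ 2 * ∫ z, fderiv ℝ φ z.1 (field H G 0 0 ub usb z.1 z.2)
        ∂(ν₀.toMeasure.prod ν₀.toMeasure) +
      q * (1 - q) * ∫ z, fderiv ℝ φ z.1 (field H G 0 1 ub usb z.1 z.2)
        ∂(ν₀.toMeasure.prod ν₀.toMeasure) +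
      q * (1 - q) * ∫ z, fderiv ℝ φ z.1 (field H G 1 0 ub usb z.1 z.2)
        ∂(ν₀.toMeasure.prod ν₀.toMeasure) +
      q ^ 2 * ∫ z, fderiv ℝ φ z.1 (field H G 1 1 ub usb z.1 z.2)
        ∂(ν₀.toMeasure.prod ν₀.toMeasure) := by
  obtain ⟨L, hL0, hL, -⟩ := hφ.exists_lipschitz_bound
  have hI : ∀ θ θs, θ = 0 ∨ θ = 1 → θs = 0 ∨ θs = 1 → Integrable (fun z : E d × E d =>
      fderiv ℝ φ z.1 (field H G θ θs ub usb z.1 z.2)) (ν₀.toMeasure.prod ν₀.toMeasure) :=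
    fun θ θs hθ hθs => Integrable.of_bound
      ((hφ.continuous_fderiv.comp continuous_fst).clm_apply
        (continuous_field hH hG θ θs ub usb)).aestronglyMeasurable (L * M)
      (Eventually.of_forall fun z => (ContinuousLinearMap.le_of_opNorm_le _ (hL z.1) _).trans
        (mul_le_mul_of_nonneg_left (hMb θ θs hθ hθs _ _) hL0))
  have hy : ∀ x, Integrable (fun y => avgKernel H G q ub usb x y) ν₀.toMeasure := fun x => by
    have hf : ∀ θ θs, θ = 0 ∨ θ = 1 → θs = 0 ∨ θs = 1 →
        Integrable (fun y => field H G θ θs ub usb x y) ν₀.toMeasure := fun θ θs hθ hθs =>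
      Integrable.of_bound ((continuous_field hH hG θ θs ub usb).comp
        (Continuous.prodMk_right x)).aestronglyMeasurable M
        (Eventually.of_forall fun y => hMb θ θs hθ hθs x y)
    have g00 := (hf 0 0 (by simp) (by simp)).smul ((1 - q) ^ 2)
    have g01 := (hf 0 1 (by simp) (by simp)).smul (q * (1 - q))
    have g10 := (hf 1 0 (by simp) (by simp)).smul (q * (1 - q))
    have g11 := (hf 1 1 (by simp) (by simp)).smul (q ^ 2)
    exact (((g00.add g01).add g10).add g11).congr
      (Eventually.of_forall fun y => (avgKernel_eq_sum_field q ub usb x y).symm)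
  have i00 := (hI 0 0 (by simp) (by simp)).const_mul ((1 - q) ^ 2)
  have i01 := (hI 0 1 (by simp) (by simp)).const_mul (q * (1 - q))
  have i10 := (hI 1 0 (by simp) (by simp)).const_mul (q * (1 - q))
  have i11 := (hI 1 1 (by simp) (by simp)).const_mul (q ^ 2)
  have hsplit : ∀ z : E d × E d, fderiv ℝ φ z.1 (avgKernel H G q ub usb z.1 z.2) =
      (1 - q) ^ 2 * fderiv ℝ φ z.1 (field H G 0 0 ub usb z.1 z.2) +
      q * (1 - q) * fderiv ℝ φ z.1 (field H G 0 1 ub usb z.1 z.2) +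
      q * (1 - q) * fderiv ℝ φ z.1 (field H G 1 0 ub usb z.1 z.2) +
      q ^ 2 * fderiv ℝ φ z.1 (field H G 1 1 ub usb z.1 z.2) := fun z => by
    rw [avgKernel_eq_sum_field]
    simp only [map_add, map_smul, smul_eq_mul]
  have hi : Integrable (fun z : E d × E d => fderiv ℝ φ z.1 (avgKernel H G q ub usb z.1 z.2))
      (ν₀.toMeasure.prod ν₀.toMeasure) :=
    (((i00.add i01).add i10).add i11).congr (Eventually.of_forall fun z => (hsplit z).symm)
  have h1 : ∀ x, inner ℝ (∇ φ x) (∫ y, avgKernel H G q ub usb x y ∂ν₀.toMeasure) =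
      ∫ y, fderiv ℝ φ x (avgKernel H G q ub usb x y) ∂ν₀.toMeasure := fun x => by
    rw [← InnerProductSpace.toDual_apply_apply (𝕜 := ℝ), toDual_gradient,
      ContinuousLinearMap.integral_comp_comm _ (hy x)]
  rw [integral_congr_ae (Eventually.of_forall h1), ← integral_prod (fun z : E d × E d =>
      fderiv ℝ φ z.1 (avgKernel H G q ub usb z.1 z.2)) hi,
    integral_congr_ae (Eventually.of_forall hsplit), integral_add ((i00.fun_add i01).fun_add i10) i11,
    integral_add (i00.fun_add i01) i10, integral_add i00 i01, integral_const_mul, integral_const_mul,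
    integral_const_mul, integral_const_mul]

/-- The grazing limit of the scaled interaction operator. -/
theorem tendsto_scaled_collision (hΘ : HasLaw Θ (bernoulliMeasure (1 : ℝ) 0 p) P)
    (hΘs : HasLaw Θs (bernoulliMeasure (1 : ℝ) 0 p) P) (hind : IndepFun Θ Θs P)
    (hH : IsInteractionKernel H)
    (hG : ∀ ℓ, IsInteractionKernel (G ℓ)) (hε : ∀ n, 0 < ε n) (hε0 : Tendsto ε atTop (𝓝 0))
    (hu : Tendsto u atTop (𝓝 ub)) (hus : Tendsto us atTop (𝓝 usb))
    (hν : Tendsto (fun n => (ν n).toProbabilityMeasure) atTop (𝓝 ν₀.toProbabilityMeasure))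
    {M : ℝ} (hM : ∀ θ θs : ℝ, θ = 0 ∨ θ = 1 → θs = 0 ∨ θs = 1 → ∀ n x y,
      ‖field H G θ θs (u n) (us n) x y‖ ≤ M)
    (hMb : ∀ θ θs : ℝ, θ = 0 ∨ θ = 1 → θs = 0 ∨ θs = 1 → ∀ x y,
      ‖field H G θ θs ub usb x y‖ ≤ M) (hφ : IsTestFunction φ) :
    Tendsto (fun n => collision P Θ Θs H G (ε n) (1 / ε n) (u n) (us n) (ν n) φ) atTop
      (𝓝 (∫ x, inner ℝ (∇ φ x) (∫ y, avgKernel H G (p : ℝ) ub usb x y ∂ν₀.toMeasure)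
        ∂ν₀.toMeasure)) := by
  have hD := fun θ θs (hθ : θ = 0 ∨ θ = 1) (hθs : θs = 0 ∨ θs = 1) =>
    tendsto_scaled_collision_of_indicators hH hG hε hε0 hu hus hν (hM θ θs hθ hθs)
      (hMb θ θs hθ hθs) hφ
  have hsum := ((((hD 0 0 (by simp) (by simp)).const_mul ((1 - (p : ℝ)) ^ 2)).add
    ((hD 0 1 (by simp) (by simp)).const_mul ((p : ℝ) * (1 - p)))).add
    ((hD 1 0 (by simp) (by simp)).const_mul ((p : ℝ) * (1 - p)))).add
    ((hD 1 1 (by simp) (by simp)).const_mul ((p : ℝ) ^ 2))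
  rw [integral_inner_avgKernel_eq hH hG hMb hφ]
  refine hsum.congr fun n => ?_
  rw [collision, integral_bernoulli_pair hΘ hΘs hind fun θ θs => ∫ y, (∫ x,
    (φ (postState H G (ε n) θ θs (u n) (us n) x y) - φ x) ∂(ν n).toMeasure) ∂(ν n).toMeasure]
  simp only [smul_eq_mul]
  ring

end limit

/-! ### Compactness of the family of curves -/

section compactness

variable {d : ℕ}

theorem P1.lintegral_enorm_eq (μ : P1 d) :
    ∫⁻ x, ‖x‖ₑ ∂μ.toMeasure = ENNReal.ofReal (∫ x, ‖x‖ ∂μ.toMeasure) := by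
  rw [ofReal_integral_eq_lintegral_ofReal μ.integrable_norm
    (Eventually.of_forall fun x => norm_nonneg x)]
  simp only [ofReal_norm]

/-- A bound on the first moment gives relative compactness for weak convergence. -/
theorem isCompact_closure_moment_le (m : ℝ) :
    IsCompact (closure {ν : ProbabilityMeasure (E d) |
      ∃ μ : P1 d, μ.toProbabilityMeasure = ν ∧ ∫ x, ‖x‖ ∂μ.toMeasure ≤ m}) := by
  refine isCompact_closure_of_isTightMeasureSet
    (isTightMeasureSet_of_tendsto_measure_norm_gt ?_)
  have hlim : Tendsto (fun r : ℝ => ENNReal.ofReal m / ENNReal.ofReal r) atTop (𝓝 0) := by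
    have := ENNReal.Tendsto.const_div (a := ENNReal.ofReal m) ENNReal.tendsto_ofReal_atTop
      (Or.inr ENNReal.ofReal_ne_top)
    rwa [ENNReal.div_top] at this
  refine tendsto_of_tendsto_of_tendsto_of_le_of_le' tendsto_const_nhds hlim
    (Eventually.of_forall fun _ => zero_le) ?_
  filter_upwards [eventually_gt_atTop 0] with r hr
  refine iSup₂_le ?_
  rintro _ ⟨_, ⟨μ, rfl, hμ⟩, rfl⟩
  calc μ.toMeasure {x | r < ‖x‖} ≤ μ.toMeasure {x | ENNReal.ofReal r ≤ ‖x‖ₑ} := by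
        refine measure_mono fun x (hx : r < ‖x‖) => ?_
        show ENNReal.ofReal r ≤ ‖x‖ₑ
        rw [← ofReal_norm]
        exact ENNReal.ofReal_le_ofReal hx.le
    _ ≤ (∫⁻ x, ‖x‖ₑ ∂μ.toMeasure) / ENNReal.ofReal r :=
        meas_ge_le_lintegral_div measurable_enorm.aemeasurable (ENNReal.ofReal_pos.2 hr).ne'
          ENNReal.ofReal_ne_top
    _ ≤ ENNReal.ofReal m / ENNReal.ofReal r := by
        rw [μ.lintegral_enorm_eq]
        exact ENNReal.div_le_div_right (ENNReal.ofReal_le_ofReal hμ) _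

/-- Lower semicontinuity of the first moment under weak convergence; it keeps the weak limits inside
`P1`. -/
theorem lintegral_enorm_le_of_tendsto {ν : ℕ → ProbabilityMeasure (E d)}
    {ν₀ : ProbabilityMeasure (E d)} (h : Tendsto ν atTop (𝓝 ν₀)) {m : ℝ≥0∞}
    (hm : ∀ n, ∫⁻ x, ‖x‖ₑ ∂(ν n : Measure (E d)) ≤ m) :
    ∫⁻ x, ‖x‖ₑ ∂(ν₀ : Measure (E d)) ≤ m := by
  have h1 := lintegral_le_liminf_lintegral_of_forall_isOpen_measure_le_liminf_measure
    (μ := (ν₀ : Measure (E d))) (μs := fun n => (ν n : Measure (E d))) (f := fun x => ‖x‖)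
    continuous_norm (fun x => norm_nonneg x)
    (fun V hV => ProbabilityMeasure.le_liminf_measure_open_of_tendsto h hV)
  simp only [ofReal_norm] at h1
  refine h1.trans ((liminf_le_liminf (Eventually.of_forall hm)).trans ?_)
  simp

theorem exists_P1_of_lintegral_le {ν : ProbabilityMeasure (E d)} {m : ℝ} (hm0 : 0 ≤ m)
    (hm : ∫⁻ x, ‖x‖ₑ ∂(ν : Measure (E d)) ≤ ENNReal.ofReal m) :
    ∃ μ : P1 d, μ.toProbabilityMeasure = ν ∧ ∫ x, ‖x‖ ∂μ.toMeasure ≤ m := by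
  have hint : Integrable (fun x => ‖x‖) (ν : Measure (E d)) :=
    ⟨continuous_norm.aestronglyMeasurable, by
      simpa [HasFiniteIntegral] using hm.trans_lt ENNReal.ofReal_lt_top⟩
  let μ : P1 d := ⟨ν, inferInstance, hint⟩
  exact ⟨μ, rfl, (ENNReal.ofReal_le_ofReal_iff hm0).1 (μ.lintegral_enorm_eq.symm.trans_le hm)⟩

/-- An equicontinuous, relatively compact sequence of curves of probability measures has a
subsequence that converges at every time. -/
theorem exists_subseq_tendsto_probabilityMeasure {T : ℝ} (hT : 0 ≤ T)
    {K : Set (ProbabilityMeasure (E d))} (hK : IsCompact K)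
    {ν : ℕ → ℝ → ProbabilityMeasure (E d)} (hν : ∀ n, ∀ t ∈ Icc 0 T, ν n t ∈ K)
    (hlip : ∀ φ : E d → ℝ, IsTestFunction φ → ∃ L : ℝ, ∀ n, ∀ s ∈ Icc 0 T, ∀ t ∈ Icc 0 T,
      |∫ x, φ x ∂(ν n t : Measure (E d)) - ∫ x, φ x ∂(ν n s : Measure (E d))| ≤ L * |t - s|) :
    ∃ k : ℕ → ℕ, StrictMono k ∧ ∀ t ∈ Icc 0 T, ∃ ν₀ : ProbabilityMeasure (E d),
      Tendsto (fun n => ν (k n) t) atTop (𝓝 ν₀) := by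
  -- Rational times, clamped to `[0, T]`, form a countable family, so a single subsequence converges
  -- at all of them by compactness of the product.
  let x : ℕ → ℚ → ProbabilityMeasure (E d) := fun n q => ν n (projIcc 0 T hT q)
  obtain ⟨l, -, k, hk, hl⟩ := (isCompact_univ_pi fun _ : ℚ => hK).isSeqCompact
    (x := x) fun n => mem_univ_pi.2 fun q => hν n _ (projIcc 0 T hT q).2
  refine ⟨k, hk, fun t ht => ?_⟩
  -- At a general time compactness only gives a cluster point. Equicontinuity makes each integral
  -- sequence Cauchy, which forces the whole sequence to converge to it.
  obtain ⟨ν₀, -, j, hj, hν₀⟩ := hK.isSeqCompact (x := fun n => ν (k n) t) fun n => hν _ t ht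
  refine ⟨ν₀, tendsto_probabilityMeasure_of_forall_isTestFunction fun φ hφ => ?_⟩
  have hint : ∀ {y : ℕ → ProbabilityMeasure (E d)} {y₀ : ProbabilityMeasure (E d)},
      Tendsto y atTop (𝓝 y₀) → Tendsto (fun n => ∫ x, φ x ∂(y n : Measure (E d))) atTop
        (𝓝 (∫ x, φ x ∂(y₀ : Measure (E d)))) := by
    intro y y₀ hy
    obtain ⟨B, hB⟩ := hφ.2.exists_bound_of_continuous hφ.1.continuous
    exact ProbabilityMeasure.tendsto_iff_forall_integral_tendsto.1 hy
      (BoundedContinuousFunction.ofNormedAddCommGroup φ hφ.1.continuous B hB)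
  obtain ⟨L, hL⟩ := hlip φ hφ
  refine tendsto_nhds_of_cauchySeq_of_subseq (u := fun n => ∫ x, φ x ∂(ν (k n) t : Measure (E d)))
    ?_ hj.tendsto_atTop (hint hν₀)
  refine Metric.cauchySeq_iff'.2 fun η hη => ?_
  -- The rational time is close enough that moving to it costs at most `η / 4`, twice; the Cauchy
  -- property there costs another `η / 4`. The `+ 1` avoids division by zero.
  obtain ⟨q, hq1, hq2⟩ := exists_rat_btwn (show t < t + η / (4 * (|L| + 1)) by
    have := abs_nonneg L
    have : 0 < η / (4 * (|L| + 1)) := by positivity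
    linarith)
  have hq : |t - projIcc 0 T hT q| ≤ η / (4 * (|L| + 1)) := by
    have h1 := abs_projIcc_sub_projIcc hT (c := t) (d := q)
    rw [projIcc_of_mem hT ht] at h1
    refine h1.trans ?_
    rw [abs_sub_comm, abs_of_pos (by linarith)]
    linarith
  have hLq : ∀ n, |∫ x, φ x ∂(ν n t : Measure (E d)) -
      ∫ x, φ x ∂(ν n (projIcc 0 T hT q) : Measure (E d))| ≤ η / 4 := fun n => by
    refine (hL n _ (projIcc 0 T hT q).2 t ht).trans ?_
    have h0 := abs_nonneg L
    calc L * |t - projIcc 0 T hT q| ≤ (|L| + 1) * (η / (4 * (|L| + 1))) :=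
          mul_le_mul (by linarith [le_abs_self L]) hq (abs_nonneg _) (by linarith)
      _ = η / 4 := by field_simp
  obtain ⟨N, hN⟩ := Metric.cauchySeq_iff'.1 (hint (tendsto_pi_nhds.1 hl q)).cauchySeq (η / 4)
    (by linarith)
  refine ⟨N, fun n hn => ?_⟩
  have h1 := hN n hn
  rw [Real.dist_eq] at h1 ⊢
  have h2 := abs_lt.1 h1
  have h3 := abs_le.1 (hLq (k n))
  have h4 := abs_le.1 (hLq (k N))
  simp only [Function.comp, x] at h2
  rw [abs_lt]
  constructor <;> linarith [h2.1, h2.2, h3.1, h3.2, h4.1, h4.2]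

theorem tendsto_integral_of_tendsto {ι : Type*} {F : Filter ι} {ν : ι → P1 d} {ν₀ : P1 d}
    (h : Tendsto (fun i => (ν i).toProbabilityMeasure) F (𝓝 ν₀.toProbabilityMeasure))
    {φ : E d → ℝ} (hφ : IsTestFunction φ) :
    Tendsto (fun i => ∫ x, φ x ∂(ν i).toMeasure) F (𝓝 (∫ x, φ x ∂ν₀.toMeasure)) := by
  obtain ⟨B, hB⟩ := hφ.2.exists_bound_of_continuous hφ.1.continuous
  exact ProbabilityMeasure.tendsto_iff_forall_integral_tendsto.1 h
    (BoundedContinuousFunction.ofNormedAddCommGroup φ hφ.1.continuous B hB)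

/-- The limit is defined at every real time by clamping to `[0, T]`. The Lipschitz estimates survive
the limit, so this curve is weakly continuous on the whole line and hence measurable. -/
theorem exists_subseq_tendsto_curve {T m : ℝ} (hT : 0 ≤ T) {μ : ℕ → ℝ → P1 d}
    (hm : ∀ n, ∀ t ∈ Icc 0 T, ∫ x, ‖x‖ ∂(μ n t).toMeasure ≤ m)
    (hlip : ∀ φ : E d → ℝ, IsTestFunction φ → ∃ L : ℝ, 0 ≤ L ∧ ∀ n, ∀ s ∈ Icc 0 T, ∀ t ∈ Icc 0 T,
      |∫ x, φ x ∂(μ n t).toMeasure - ∫ x, φ x ∂(μ n s).toMeasure| ≤ L * |t - s|) :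
    ∃ (k : ℕ → ℕ) (μlim : ℝ → P1 d), StrictMono k ∧
      (∀ t ∈ Icc 0 T, Tendsto (fun n => (μ (k n) t).toProbabilityMeasure) atTop
        (𝓝 (μlim t).toProbabilityMeasure)) ∧
      (∀ t, ∫ x, ‖x‖ ∂(μlim t).toMeasure ≤ m) ∧ Measurable fun t => (μlim t).toMeasure := by
  have hm0 : 0 ≤ m :=
    (integral_nonneg fun x => norm_nonneg x).trans (hm 0 0 (left_mem_Icc.2 hT))
  obtain ⟨k, hk, hlim⟩ := exists_subseq_tendsto_probabilityMeasure hT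
    (isCompact_closure_moment_le (d := d) m) (ν := fun n t => (μ n t).toProbabilityMeasure)
    (fun n t ht => subset_closure ⟨μ n t, rfl, hm n t ht⟩)
    (fun φ hφ => (hlip φ hφ).imp fun L hL => hL.2)
  have hlim' : ∀ t : ℝ, ∃ ρ : P1 d, Tendsto (fun n =>
      (μ (k n) (projIcc 0 T hT t)).toProbabilityMeasure) atTop (𝓝 ρ.toProbabilityMeasure) ∧
      ∫ x, ‖x‖ ∂ρ.toMeasure ≤ m := fun t => by
    obtain ⟨ν₀, hν₀⟩ := hlim _ (projIcc 0 T hT t).2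
    obtain ⟨ρ, rfl, hρ⟩ := exists_P1_of_lintegral_le hm0
      (lintegral_enorm_le_of_tendsto hν₀ (m := ENNReal.ofReal m) fun n => by
        refine (P1.lintegral_enorm_eq _).trans_le (ENNReal.ofReal_le_ofReal ?_)
        exact hm _ _ (projIcc 0 T hT t).2)
    exact ⟨ρ, hν₀, hρ⟩
  choose μlim hμlim hmlim using hlim'
  refine ⟨k, μlim, hk, fun t ht => ?_, hmlim, ?_⟩
  · have := hμlim t
    rwa [projIcc_of_mem hT ht] at this
  · refine measurable_toMeasure_of_continuous (ν := fun t => (μlim t).toProbabilityMeasure)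
      (continuous_iff_continuousAt.2 fun t =>
        tendsto_probabilityMeasure_of_forall_isTestFunction fun φ hφ => ?_)
    obtain ⟨L, hL0, hL⟩ := hlip φ hφ
    have hbound : ∀ s, |∫ x, φ x ∂(μlim s).toMeasure - ∫ x, φ x ∂(μlim t).toMeasure| ≤
        L * |s - t| := fun s => by
      refine le_of_tendsto ((tendsto_integral_of_tendsto (hμlim s) hφ).sub
        (tendsto_integral_of_tendsto (hμlim t) hφ)).abs (Eventually.of_forall fun n => ?_)
      refine (hL (k n) _ (projIcc 0 T hT t).2 _ (projIcc 0 T hT s).2).trans ?_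
      exact mul_le_mul_of_nonneg_left (abs_projIcc_sub_projIcc hT) hL0
    have h1 : Tendsto (fun s : ℝ => L * |s - t|) (𝓝 t) (𝓝 (L * |t - t|)) :=
      (by fun_prop : Continuous fun s : ℝ => L * |s - t|).tendsto t
    rw [sub_self, abs_zero, mul_zero] at h1
    exact tendsto_iff_dist_tendsto_zero.2 (squeeze_zero (fun _ => dist_nonneg) hbound h1)

end compactness

/-! ### Choice of the tail radius, limits in time, and the main theorem -/

/-- Supplies a radius at which the initial tail, vanishing by dominated convergence, and the tail
created by the dynamics, of size `A / (R - 2)`, are small together. -/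
theorem exists_integral_norm_sub_pos_add_le {d : ℕ} (μ : P1 d) (A : ℝ) {δ : ℝ} (hδ : 0 < δ) :
    ∃ R : ℝ, 2 < R ∧ ∫ x, max 0 (‖x‖ - R) ∂μ.toMeasure + A / (R - 2) ≤ δ := by
  have h1 : Tendsto (fun R : ℝ => ∫ x, max 0 (‖x‖ - R) ∂μ.toMeasure) atTop
      (𝓝 (∫ _, (0 : ℝ) ∂μ.toMeasure)) := by
    refine tendsto_integral_filter_of_dominated_convergence (fun x => ‖x‖)
      (Eventually.of_forall fun R => (by fun_prop : Continuous fun x : E d =>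
        max 0 (‖x‖ - R)).aestronglyMeasurable) ?_ μ.integrable_norm
      (Eventually.of_forall fun x => ?_)
    · filter_upwards [eventually_ge_atTop 0] with R hR
      refine Eventually.of_forall fun x => ?_
      rw [Real.norm_of_nonneg (le_max_left _ _)]
      exact max_le (norm_nonneg _) (by linarith)
    · refine tendsto_const_nhds.congr' ?_
      filter_upwards [eventually_ge_atTop ‖x‖] with R hR
      rw [max_eq_left (by linarith)]
  have h2 : Tendsto (fun R : ℝ => A / (R - 2)) atTop (𝓝 0) :=
    Tendsto.div_atTop tendsto_const_nhds (tendsto_atTop_add_const_right _ (-2) tendsto_id)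
  have h3 := h1.add h2
  simp only [integral_zero, add_zero] at h3
  obtain ⟨R, hR, hR2⟩ := (((tendsto_order.1 h3).2 δ hδ).and (eventually_gt_atTop 2)).exists
  exact ⟨R, hR2, hR.le⟩

theorem isL2Curve_of_measurable_of_bounded {d : ℕ} {T m : ℝ} {μ : ℝ → P1 d}
    (hμ : Measurable fun t => (μ t).toMeasure) (hm : ∀ t, ∫ x, ‖x‖ ∂(μ t).toMeasure ≤ m) :
    IsL2Curve T μ := by
  refine ⟨hμ.aemeasurable, MemLp.of_bound (Measurable.aestronglyMeasurable ?_) m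
    (Eventually.of_forall fun t => ?_)⟩
  · have h1 : ∀ t, ∫ x, ‖x‖ ∂(μ t).toMeasure = (∫⁻ x, ‖x‖ₑ ∂(μ t).toMeasure).toReal := fun t => by
      rw [P1.lintegral_enorm_eq, ENNReal.toReal_ofReal (integral_nonneg fun x => norm_nonneg x)]
    simp only [h1]
    exact ((Measure.measurable_lintegral measurable_enorm).comp hμ).ennreal_toReal
  · rw [Real.norm_of_nonneg (integral_nonneg fun x => norm_nonneg x)]
    exact hm t

/-- Passing to the limit in Carathéodory derivatives under a uniform bound. -/
theorem isCaratheodoryDerivative_of_tendsto {T B : ℝ} (hT : 0 ≤ T) {f g : ℕ → ℝ → ℝ}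
    {f₀ g₀ : ℝ → ℝ} (h : ∀ n, IsCaratheodoryDerivative T (f n) (g n))
    (hf : ∀ t ∈ Icc 0 T, Tendsto (fun n => f n t) atTop (𝓝 (f₀ t)))
    (hg : ∀ t ∈ Icc 0 T, Tendsto (fun n => g n t) atTop (𝓝 (g₀ t)))
    (hB : ∀ n, ∀ t ∈ Icc 0 T, |g n t| ≤ B) : IsCaratheodoryDerivative T f₀ g₀ := by
  have hsub : ∀ t ∈ Icc 0 T, uIoc 0 t ⊆ Icc 0 T := fun t ht => by
    rw [uIoc_of_le ht.1]
    exact Ioc_subset_Icc_self.trans (Icc_subset_Icc_right ht.2)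
  have hTT : T ∈ Icc 0 T := right_mem_Icc.2 hT
  have hae : ∀ t ∈ Icc 0 T, ∀ {q : ℝ → Prop}, (∀ s ∈ Icc 0 T, q s) →
      ∀ᵐ s ∂volume.restrict (uIoc 0 t), q s := fun t ht q hq =>
    (ae_restrict_iff' measurableSet_uIoc).2 (Eventually.of_forall fun s hs => hq s (hsub t ht hs))
  have hmeas : ∀ n, ∀ t ∈ Icc 0 T,
      AEStronglyMeasurable (g n) (volume.restrict (uIoc 0 t)) := fun n t ht => by
    have h1 := (h n).1.def'.aestronglyMeasurable
    refine h1.mono_measure (Measure.restrict_mono ?_ le_rfl)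
    rw [uIoc_of_le ht.1, uIoc_of_le hT]
    exact Ioc_subset_Ioc_right ht.2
  refine ⟨intervalIntegrable_iff.2 ?_, fun t ht => ?_⟩
  · have : IsFiniteMeasure ((volume : Measure ℝ).restrict (uIoc 0 T)) := by
      rw [uIoc_of_le hT]; infer_instance
    refine Integrable.of_bound (aestronglyMeasurable_of_tendsto_ae atTop (fun n => hmeas n T hTT)
      (hae T hTT hg)) B (hae T hTT fun s hs => ?_)
    exact le_of_tendsto (hg s hs).abs (Eventually.of_forall fun n => hB n s hs)
  · have h1 : Tendsto (fun n => ∫ s in (0 : ℝ)..t, g n s) atTop (𝓝 (∫ s in (0 : ℝ)..t, g₀ s)) := by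
      refine intervalIntegral.tendsto_integral_filter_of_dominated_convergence (fun _ => B)
        (Eventually.of_forall fun n => hmeas n t ht)
        (Eventually.of_forall fun n => Eventually.of_forall fun s hs => hB n s (hsub t ht hs))
        intervalIntegrable_const (Eventually.of_forall fun s hs => hg s (hsub t ht hs))
    exact tendsto_nhds_unique ((hf t ht).congr fun n => (h n).2 t ht)
      ((hf 0 (left_mem_Icc.2 hT)).add h1)

theorem P1.toProbabilityMeasure_injective {d : ℕ} :
    Function.Injective (P1.toProbabilityMeasure (d := d)) := fun _ _ h =>
  Subtype.ext (congrArg (fun ρ : ProbabilityMeasure (E d) => (ρ : Measure (E d))) h)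

end KineticLimit

theorem mainTheorem4 {d : ℕ} {Ω : Type*} [MeasurableSpace Ω] (P : Measure Ω)
    [IsProbabilityMeasure P] (p : unitInterval) (Θ Θs : Ω → ℝ)
    (hΘ : HasLaw Θ (bernoulliMeasure (1 : ℝ) 0 p) P)
    (hΘs : HasLaw Θs (bernoulliMeasure (1 : ℝ) 0 p) P)
    (hind : IndepFun Θ Θs P)
    (H : E d → E d) (G : Fin d → E d → E d)
    (hH : IsInteractionKernel H) (hG : ∀ ℓ, IsInteractionKernel (G ℓ))
    (T : ℝ) (hT : 0 < T)
    (U : Set (E d)) (hU : IsCompact U)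
    (u us : ℝ → ℝ → E d) (ubar usbar : ℝ → E d)
    (hu : ∀ α, 0 < α → Measurable (u α)) (hus : ∀ α, 0 < α → Measurable (us α))
    (huU : ∀ α, 0 < α → ∀ t ∈ Icc 0 T, u α t ∈ U)
    (husU : ∀ α, 0 < α → ∀ t ∈ Icc 0 T, us α t ∈ U)
    (hulim : ∀ t ∈ Icc 0 T, Tendsto (fun α => u α t) (𝓝[>] 0) (𝓝 (ubar t)))
    (huslim : ∀ t ∈ Icc 0 T, Tendsto (fun α => us α t) (𝓝[>] 0) (𝓝 (usbar t)))
    (μ₀ : P1 d) (μ : ℝ → ℝ → P1 d)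
    (hμ : ∀ ε, 0 < ε →
      IsBoltzmannWeakSolution P Θ Θs H G T ε (1 / ε) (u ε) (us ε) μ₀ (μ ε)) :
    (∀ a b x y : E d,
      ∫ w, field H G (Θ w) (Θs w) a b x y ∂P = avgKernel H G (p : ℝ) a b x y) ∧
    ∀ ε : ℕ → ℝ, (∀ n, 0 < ε n) → Tendsto ε atTop (𝓝 0) →
      ∃ (k : ℕ → ℕ) (μlim : ℝ → P1 d), StrictMono k ∧
        (∀ t ∈ Icc 0 T, Tendsto (fun n => W1 (μ (ε (k n)) t) (μlim t)) atTop (𝓝 0)) ∧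
        IsContinuityWeakSolution T
          (fun t x y => avgKernel H G (p : ℝ) (ubar t) (usbar t) x y) μ₀ μlim := by

  refine ⟨integral_field hΘ hΘs hind H G, fun ε hε hε0 => ?_⟩
  have h01 := ae_eq_zero_or_one_of_hasLaw_bernoulli hΘ
  have h01s := ae_eq_zero_or_one_of_hasLaw_bernoulli hΘs
  obtain ⟨M, hM0, hM⟩ := exists_field_bound hH hG hU
  have hMε : ∀ α, 0 < α → ∀ θ θs : ℝ, θ = 0 ∨ θ = 1 → θs = 0 ∨ θs = 1 → ∀ t ∈ Icc 0 T, ∀ x y,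
      ‖field H G θ θs (u α t) (us α t) x y‖ ≤ M := fun α hα θ θs hθ hθs t ht =>
    hM θ θs hθ hθs _ (huU α hα t ht) _ (husU α hα t ht)
  set m : ℝ := ∫ x, ‖x‖ ∂μ₀.toMeasure + M * T
  obtain ⟨k, μlim, hk, hlim, hmlim, hmeas⟩ := exists_subseq_tendsto_curve hT.le
    (μ := fun n => μ (ε n)) (m := m)
    (fun n t ht => (hμ _ (hε n)).integral_norm_le h01 h01s (hε n) hM0 (hMε _ (hε n)) ht)
    (fun φ hφ => by
      obtain ⟨L, hL0, -, hL⟩ := hφ.exists_lipschitz_bound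
      exact ⟨L * M, mul_nonneg hL0 hM0.le, fun n s hs t ht =>
        (hμ _ (hε n)).abs_integral_sub_le_of_lipschitz h01 h01s (hε n) (hMε _ (hε n)) hφ hL0 hL
          hs ht⟩)
  have hεk : Tendsto (fun n => ε (k n)) atTop (𝓝 0) := hε0.comp hk.tendsto_atTop
  have hεk' : Tendsto (fun n => ε (k n)) atTop (𝓝[>] 0) :=
    tendsto_nhdsWithin_iff.2 ⟨hεk, Eventually.of_forall fun n => hε (k n)⟩
  refine ⟨k, μlim, hk, fun t ht => tendsto_W1_of_tendsto_of_tail (hlim t ht) fun δ hδ => ?_,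
    isL2Curve_of_measurable_of_bounded hmeas hmlim, ?_, fun φ hφ => ?_⟩
  · obtain ⟨r, hr0, hrδ⟩ := ENNReal.lt_iff_exists_nnreal_btwn.1 hδ
    -- `M * m * T` is the numerator in `integral_tail_le`; the half offsets the factor `2` in
    -- `lintegral_tail_le`.
    obtain ⟨R, hR2, hR⟩ := exists_integral_norm_sub_pos_add_le μ₀ (M * m * T)
      (δ := r / 2) (half_pos (by exact_mod_cast hr0))
    refine ⟨2 * R, ?_⟩
    -- The tail estimate needs jumps of length at most `1`, which holds once `ε` is small.
    have hev : ∀ᶠ n in atTop, ε (k n) * M ≤ 1 := by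
      have h1 := hεk.mul_const M
      rw [zero_mul] at h1
      filter_upwards [(tendsto_order.1 h1).2 1 one_pos] with n hn using hn.le
    filter_upwards [hev] with n hn
    refine (lintegral_tail_le _ R).trans (le_trans ?_ hrδ.le)
    rw [← ENNReal.ofReal_coe_nnreal]
    refine ENNReal.ofReal_le_ofReal ?_
    have h1 := (hμ _ (hε (k n))).integral_tail_le h01 h01s (hε (k n)) hM0 hn (hMε _ (hε (k n)))
      ht hR2
    have h2 : M / (R - 2) * m * T = M * m * T / (R - 2) := by ring
    rw [h2] at h1
    linarith
  · refine P1.toProbabilityMeasure_injective (tendsto_nhds_unique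
      (hlim 0 (left_mem_Icc.2 hT.le)) ?_)
    simp only [(hμ _ (hε _)).initial]
    exact tendsto_const_nhds
  · obtain ⟨L, hL0, -, hL⟩ := hφ.exists_lipschitz_bound
    refine isCaratheodoryDerivative_of_tendsto (B := L * M) hT.le
      (fun n => (hμ _ (hε (k n))).weak_form φ hφ)
      (fun t ht => tendsto_integral_of_tendsto (hlim t ht) hφ) (fun t ht => ?_) fun n t ht => ?_
    · have hut := (hulim t ht).comp hεk'
      have hust := (huslim t ht).comp hεk'
      -- The limiting controls lie in the closed set `U`, so the bound `M` also covers the limiting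
      -- field.
      exact tendsto_scaled_collision hΘ hΘs hind hH hG (fun n => hε (k n)) hεk hut hust (hlim t ht)
        (fun θ θs hθ hθs n => hMε _ (hε (k n)) θ θs hθ hθs t ht)
        (fun θ θs hθ hθs => hM θ θs hθ hθs _
          (hU.isClosed.mem_of_tendsto hut (Eventually.of_forall fun n => huU _ (hε (k n)) t ht)) _
          (hU.isClosed.mem_of_tendsto hust
            (Eventually.of_forall fun n => husU _ (hε (k n)) t ht))) hφ
    · refine (abs_collision_le h01 h01s (fun θ θs hθ hθs => hMε _ (hε (k n)) θ θs hθ hθs t ht)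
        (hε (k n)) _ (g := fun _ => L * M) (integrable_const _) fun x h hh => ?_).trans_eq (by simp)
      refine (hL _ _).trans ?_
      rw [add_sub_cancel_left]
      nlinarith [mul_le_mul_of_nonneg_left hh hL0]
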